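/- **Theorem.** Let $p\ge 3$ be an integer, $q=2p$, $\lambda=2\cos\frac{\pi}{q}$ and $\alpha\in\left[\frac12,\frac1\lambda\right]$. *Notation.* On $[(\alpha-1)\lambda,\alpha\lambda)$ let $T_\alpha(0)=0$ and $T_\alpha(t)=\frac{\varepsilon(t)}{t}-\lambda\, d(t)$ for $t\ne0$, with $\varepsilon(t)=\operatorname{sgn}(t)$ and $d(t)=\left\lfloor\left|\frac1{\lambda t}\right|+1-\alpha\right\rfloor$ (the same formulas define $T_\alpha(\alpha\lambda)$). For real $x$ put $d_0=\left\lfloor\frac{x}{\lambda}+1-\alpha\right\rfloor$, so that $x'=x-d_0\lambda\in[(\alpha-1)\lambda,\alpha\lambda)$, and $d_n=d(T_\alpha^{n-1}(x'))$, $\varepsilon_n=\varepsilon(T_\alpha^{n-1}(x'))$ for $n\ge1$. The $\alpha$-Rosen convergents $p_n/q_n$ of $x$ are given by $p_{-1}=1$, $p_0=d_0\lambda$, $q_{-1}=0$, $q_0=1$, $p_n=d_n\lambda p_{n-1}+\varepsilon_np_{n-2}$, $q_n=d_n\lambda q_{n-1}+\varepsilon_nq_{n-2}$, and $\Theta_n=q_n^2\left|x-\frac{p_n}{q_n}\right|$.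 The group $G_q$ is generated by $x\mapsto x+\lambda$ and $x\mapsto-\frac1x$; a real number is $G_q$-irrational if it is not in the $G_q$-orbit of $\infty$. For $\beta\in\left[\frac12,\frac1\lambda\right)$ the natural extension is the map $$\mathcal T_\beta(t,v)=\left(T_\beta(t),\frac1{d(t)\lambda+\varepsilon(t)v}\right)\quad\text{on}\quad \Omega_\beta=\bigcup_{n=1}^{2p-1}J_n\times[0,H_n],$$ where, with $l_n=T_\beta^n((\beta-1)\lambda)$ and $r_n=T_\beta^n(\beta\lambda)$, $J_{2n-1}=[l_{n-1},r_n)$ and $J_{2n}=[r_n,l_n)$ for $1\le n\le p-1$, $J_{2p-1}=[l_{p-1},r_0)$, and $H_1=\frac1{\lambda+1}$, $H_2=\frac1\lambda$, $H_n=\frac1{\lambda-H_{n-2}}$ for $3\le n\le 2p-1$. Put $\beta=\alpha$ if $\alpha<\frac1\lambda$, and $\beta=\frac12$ if $\alpha=\frac1\lambda$. *Claim.* For every $k\ge0$ there is exactly one point $(\tau_k,\nu_k)\in\Omega_\beta$ with $\mathcal T_\beta^{k(p-1)}(\tau_k,\nu_k)=(-\delta_1,\lambda-1)$, where $\delta_1=\frac1{(\beta+1)\lambda}$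 (so the base point is $\left(-\frac2{3\lambda},\lambda-1\right)$ when $\alpha=\frac1\lambda$). Put $$c_k=\frac{-\tau_{k-1}}{1+\tau_{k-1}\nu_{k-1}}\qquad(k\ge1).$$ There is a positive integer $K$, depending only on $q$ and $\alpha$, such that for every $G_q$-irrational $x$ and all positive integers $n$ and $k>K$, $$\min\{\Theta_{n-1},\Theta_n,\ldots,\Theta_{n+k(p-1)}\}<c_k .$$ Moreover $c_{k+1}<c_k$ for every $k\ge1$, and $\lim_{k\to\infty}c_k=\frac12$. -/

import Mathlib

open Filter Topology

noncomputable section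

namespace AlphaRosen

/-! Throughout, `l` is the real number `λ = 2 cos (π / q)` and `α` is the parameter of the
`α`-Rosen fractions. -/

/-- The digit `d(x) = ⌊|1 / (λ x)| + 1 - α⌋`. -/
def digit (l α x : ℝ) : ℤ := ⌊|1 / (l * x)| + 1 - α⌋

/-- The `α`-Rosen operator `T_α(x) = ε / x - λ ⌊ε / (λ x) + 1 - α⌋` with `ε = sgn x`,
and `T_α(0) = 0`. -/
def T (l α x : ℝ) : ℝ :=
  if x = 0 then 0
  else Real.sign x / x - l * (⌊Real.sign x / (l * x) + 1 - α⌋ : ℤ)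

/-- The integer part: the integer `d₀` with `x - d₀ λ ∈ [(α - 1) λ, α λ)`.
It is `0` when `x` already lies in that interval. -/
def intPart (l α x : ℝ) : ℤ := ⌊x / l + 1 - α⌋

/-- The representative `x - d₀ λ` of `x` in `[(α - 1) λ, α λ)`. -/
def fracPart (l α x : ℝ) : ℝ := x - intPart l α x * l

/-- `dₙ(x) = d(T_α^{n-1}(x))` for `n ≥ 1`. -/
def d (l α x : ℝ) (n : ℕ) : ℝ := (digit l α ((T l α)^[n - 1] (fracPart l α x)) : ℝ)

/-- `εₙ(x) = sgn(T_α^{n-1}(x))` for `n ≥ 1`. -/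
def eps (l α x : ℝ) (n : ℕ) : ℝ := Real.sign ((T l α)^[n - 1] (fracPart l α x))

/-- The numerators `pₙ` of the convergents: `p₋₁ = 1`, `p₀ = d₀ λ`,
`pₙ = dₙ λ pₙ₋₁ + εₙ pₙ₋₂`. -/
def num (l α x : ℝ) : ℕ → ℝ
  | 0 => intPart l α x * l
  | 1 => d l α x 1 * l * (intPart l α x * l) + eps l α x 1
  | n + 2 => d l α x (n + 2) * l * num l α x (n + 1) + eps l α x (n + 2) * num l α x n

/-- The denominators `qₙ` of the convergents: `q₋₁ = 0`, `q₀ = 1`,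
`qₙ = dₙ λ qₙ₋₁ + εₙ qₙ₋₂`. -/
def den (l α x : ℝ) : ℕ → ℝ
  | 0 => 1
  | 1 => d l α x 1 * l
  | n + 2 => d l α x (n + 2) * l * den l α x (n + 1) + eps l α x (n + 2) * den l α x n

/-- The approximation coefficient `Θₙ(x) = qₙ² |x - pₙ / qₙ|`. -/
def Theta (l α x : ℝ) (n : ℕ) : ℝ := den l α x n ^ 2 * |x - num l α x n / den l α x n|

/-- The matrix of `x ↦ x + λ`. -/
def matS (l : ℝ) : Matrix.SpecialLinearGroup (Fin 2) ℝ :=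
  ⟨!![1, l; 0, 1], by simp [Matrix.det_fin_two]⟩

/-- The matrix of `x ↦ -1 / x`. -/
def matT : Matrix.SpecialLinearGroup (Fin 2) ℝ :=
  ⟨!![0, -1; 1, 0], by simp [Matrix.det_fin_two]⟩

/-- The Hecke group `G_q`, generated by `x ↦ x + λ` and `x ↦ -1 / x`
(as matrices, so that both signs of each element occur). -/
def Hecke (l : ℝ) : Subgroup (Matrix.SpecialLinearGroup (Fin 2) ℝ) :=
  Subgroup.closure {matS l, matT}

/-- The `G_q`-rationals: the finite points of the `G_q`-orbit of `∞`. -/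
def IsGRational (l x : ℝ) : Prop :=
  ∃ M ∈ Hecke l, M.1 1 0 ≠ 0 ∧ x = M.1 0 0 / M.1 1 0

/-- The natural extension map `𝒯_α(t, v) = (T_α(t), 1 / (d(t) λ + ε(t) v))`. -/
def natExt (l α : ℝ) (P : ℝ × ℝ) : ℝ × ℝ :=
  (T l α P.1, 1 / (digit l α P.1 * l + Real.sign P.1 * P.2))

/-- `lₙ = T_α^n((α - 1) λ)`. -/
def lpt (l α : ℝ) (n : ℕ) : ℝ := (T l α)^[n] ((α - 1) * l)

/-- `rₙ = T_α^n(α λ)`. -/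
def rpt (l α : ℝ) (n : ℕ) : ℝ := (T l α)^[n] (α * l)

/-- The heights `H₁ = 1 / (λ + 1)`, `H₂ = 1 / λ`, `Hₙ = 1 / (λ - Hₙ₋₂)`; the dummy value
`H₀ = 0` makes the recursion give `H₂ = 1 / λ`. -/
def height (l : ℝ) : ℕ → ℝ
  | 0 => 0
  | 1 => 1 / (l + 1)
  | n + 2 => 1 / (l - height l n)

/-- The domain `Ω_α` of the natural extension for `q = 2p` and `1/2 ≤ α < 1/λ`, that is
`⋃ J_n × [0, H_n]` over `1 ≤ n ≤ 2p - 1`, with `J_{2n-1} = [l_{n-1}, r_n)` and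
`J_{2n} = [r_n, l_n)` for `1 ≤ n ≤ p - 1`, and `J_{2p-1} = [l_{p-1}, r_0)`.
For `α = 1/2` one has `l_n = r_n` for `n ≥ 1`, so that the intervals with even index are empty
and the domain of the classical Rosen fractions is obtained. -/
def Omega (l α : ℝ) (p : ℕ) : Set (ℝ × ℝ) :=
  {P | (∃ n : ℕ, 1 ≤ n ∧ n ≤ p - 1 ∧
          P ∈ Set.Ico (lpt l α (n - 1)) (rpt l α n) ×ˢ Set.Icc 0 (height l (2 * n - 1))) ∨
       (∃ n : ℕ, 1 ≤ n ∧ n ≤ p - 1 ∧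
          P ∈ Set.Ico (rpt l α n) (lpt l α n) ×ˢ Set.Icc 0 (height l (2 * n))) ∨
       P ∈ Set.Ico (lpt l α (p - 1)) (rpt l α 0) ×ˢ Set.Icc 0 (height l (2 * p - 1))}

/-- `δ_n = 1 / ((α + n) λ)`. -/
def delta (l α : ℝ) (n : ℕ) : ℝ := 1 / ((α + n) * l)

/-- The set `𝒯^{-k(p-1)}(base)` of backward iterates in the domain of the natural extension:
for `α < 1/λ` the natural extension is `𝒯_α` on `Ω_α` and the base point is `(-δ₁, λ - 1)`;
for `α = 1/λ` it is the one with parameter `1/2`, and the base point is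
`(-2 / (3λ), λ - 1)`, which is `(-δ₁, λ - 1)` for the parameter `1/2`. -/
def backward (l α : ℝ) (p k : ℕ) : Set (ℝ × ℝ) :=
  if α = 1 / l then
    {P | P ∈ Omega l (1 / 2) p ∧
      (natExt l (1 / 2))^[k * (p - 1)] P = (-2 / (3 * l), l - 1)}
  else
    {P | P ∈ Omega l α p ∧
      (natExt l α)^[k * (p - 1)] P = (-delta l α 1, l - 1)}

/-- `c_k = -τ_{k-1} / (1 + τ_{k-1} ν_{k-1})` for `k ≥ 1`. -/
def c (τ ν : ℕ → ℝ) (k : ℕ) : ℝ := -τ (k - 1) / (1 + τ (k - 1) * ν (k - 1))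

end AlphaRosen

end

/-! Let (t_n, v_n) be the orbit of (x', 0) under the natural extension. Then v_n = q_{n-1}/q_n,
Θ_{n-1} = v_n/(1 + t_n v_n) and Θ_n = |t_n|/(1 + t_n v_n) (`Theta_eq`). The orbit stays in a region
`Inv`, where v is bounded by heights according to the position of t among the points r_m and l_m
(`Inv_natExt`).

Suppose that all Θ in the window are at least c_k > 1/2. Then t < 0 and -1/t - v ≤ 1/c_k < 2
throughout (`stretch_of_Theta`). With the height bounds this leaves only the digits 1 and 2, and
every 2 is followed by exactly p - 2 ones before the next 2. At the digits 2 put y = -1/t - λ and η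
= v - λ. One block acts on both coordinates by y ↦ (2y - λ)/(2 - λy) (`block_rel`), a hyperbolic map
with repelling fixed point 1 and attracting fixed point -1; it multiplies (1 - y)/(1 + y) by (2 +
λ)/(2 - λ) (`cross_rel`). The backward iterates are τ_k = -1/(λ + y_k), ν_k = λ - 1, with y_0 = βλ,
so c_{k+1} = 1/(1 + y_k) = (1 + ρ_k)/2 with ρ_k geometric. Monotonicity and the limit 1/2 follow.

Case α < 1/λ (`not_stretch_of_lt`). If the first digit 2 occurs left of r_{p-1}, then v < λ - 1
forces y below the y-coordinate of τ_{k-1}, and k - 1 blocks push y below αλ, where the digit is no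
longer 2. Otherwise y exceeds 1 by a fixed amount and only boundedly many blocks fit; this is the
source of K.

Case α = 1/λ (`not_stretch_of_eq`). Digit 2 forces y ≥ 1, so the obstruction comes from η: it starts
at most -λ/2 and is drawn to -1, while Θ ≥ c_k keeps it at least y - 1/c_k. The bound -λ/2 mirrors
y_0 = λ/2, which is why β = 1/2 appears.

Uniqueness of (τ_k, ν_k): λ - 1 is the height H_{2p-3}, and tracing heights backwards determines the
digits (`back_block`). -/

namespace AlphaRosen

/-! ### Sines, heights and the affine forms that cut out the endpoints -/

/-- The properties of `S n = sin (n π / (2 p))`, with `p = r + 2`, that are used below. -/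
structure SineSeq (r : ℕ) (l : ℝ) (S : ℕ → ℝ) : Prop where
  zero : S 0 = 0
  one : 0 < S 1
  step : ∀ n, S (n + 2) = l * S (n + 1) - S n
  top : S (r + 2) = 1
  pre : S (r + 1) = l / 2
  mono : ∀ n, n ≤ r + 1 → S n < S (n + 1)
  one_lt : 1 < l
  lt_two : l < 2

theorem exists_sineSeq {r : ℕ} (hr : 1 ≤ r) {l : ℝ}
    (hl : l = 2 * Real.cos (Real.pi / (2 * (r + 2)))) : ∃ S, SineSeq r l S := by
  have hr' : (1 : ℝ) ≤ r := by exact_mod_cast hr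
  have hpi := Real.pi_pos
  set θ : ℝ := Real.pi / (2 * (r + 2)) with hθ
  have hθ0 : 0 < θ := by positivity
  have hθr : (r + 2) * θ = Real.pi / 2 := by rw [hθ]; field_simp
  -- This is where p ≥ 3 enters; it yields λ > 1.
  have hθ3 : θ < Real.pi / 3 := by
    rw [hθ]; apply div_lt_div_of_pos_left hpi (by norm_num); linarith
  refine ⟨fun n => Real.sin (n * θ), ⟨by simp, ?_, ?_, ?_, ?_, ?_, ?_, ?_⟩⟩
  · simp only [Nat.cast_one, one_mul]
    exact Real.sin_pos_of_pos_of_lt_pi hθ0 (by linarith)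
  · intro n
    have h1 : ((n + 2 : ℕ) : ℝ) * θ = (n + 1) * θ + θ := by push_cast; ring
    have h2 : (n : ℝ) * θ = (n + 1) * θ - θ := by ring
    have h3 : ((n + 1 : ℕ) : ℝ) * θ = (n + 1) * θ := by push_cast; ring
    simp only [h1, h2, h3]
    rw [Real.sin_add, Real.sin_sub, hl]; ring
  · push_cast; rw [hθr, Real.sin_pi_div_two]
  · have : ((r + 1 : ℕ) : ℝ) * θ = Real.pi / 2 - θ := by rw [← hθr]; push_cast; ring
    simp only [this]; rw [Real.sin_pi_div_two_sub, hl]; ring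
  · intro n hn
    have hn' : (n : ℝ) + 1 ≤ r + 2 := by
      have : (n : ℝ) ≤ ((r + 1 : ℕ) : ℝ) := by exact_mod_cast hn
      push_cast at this; linarith
    apply Real.sin_lt_sin_of_lt_of_le_pi_div_two
    · have : 0 ≤ (n : ℝ) * θ := by positivity
      linarith
    · rw [← hθr]; push_cast; exact mul_le_mul_of_nonneg_right hn' hθ0.le
    · push_cast; linarith
  · have : Real.cos (Real.pi / 3) < Real.cos θ :=
      Real.cos_lt_cos_of_nonneg_of_le_pi hθ0.le (by linarith) hθ3
    rw [Real.cos_pi_div_three] at this; rw [hl]; linarith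
  · have : Real.cos θ < Real.cos 0 :=
      Real.cos_lt_cos_of_nonneg_of_le_pi le_rfl (by linarith) hθ0
    rw [Real.cos_zero] at this; rw [hl]; linarith

namespace SineSeq

variable {r : ℕ} {l : ℝ} {S : ℕ → ℝ}

theorem second (h : SineSeq r l S) : S 2 = l * S 1 := by
  have := h.step 0; rw [h.zero] at this; simpa using this

theorem prepre (h : SineSeq r l S) : S r = l ^ 2 / 2 - 1 := by
  have := h.step r; rw [h.top, h.pre] at this; linarith

theorem succ_pos (h : SineSeq r l S) : ∀ n, n ≤ r + 1 → 0 < S (n + 1)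
  | 0, _ => h.one
  | n + 1, hn => (h.succ_pos n (by omega)).trans (h.mono (n + 1) hn)

/-- Cassini-type identity for the three-term recursion; its positive right side makes the heights
strictly increase. -/
theorem sq_sub (h : SineSeq r l S) (n : ℕ) : S (n + 1) ^ 2 - S n * S (n + 2) = S 1 ^ 2 := by
  induction n with
  | zero => rw [h.zero]; ring
  | succ n ih => rw [← ih, h.step (n + 1), h.step n]; ring

/-- The map H ↦ 1/(λ - H) is linearised by the recursion of the sines. The odd heights use the sums
of neighbouring sines, which obey the same recursion. -/
theorem height_even (h : SineSeq r l S) (m : ℕ) (hm : m ≤ r + 1) :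
    height l (2 * m) = S m / S (m + 1) := by
  induction m with
  | zero => simp [height, h.zero]
  | succ m ih =>
    have h1 := h.succ_pos m (by omega)
    have h2 := h.succ_pos (m + 1) (by omega)
    have e : height l (2 * (m + 1)) = 1 / (l - height l (2 * m)) := by
      rw [show 2 * (m + 1) = 2 * m + 2 by ring, height]
    have h3 := h.step m
    rw [e, ih (by omega)]
    have : l - S m / S (m + 1) = S (m + 2) / S (m + 1) := by
      rw [h3]; field_simp
    rw [this, one_div_div]

theorem height_odd (h : SineSeq r l S) (m : ℕ) (hm : m ≤ r + 1) :
    height l (2 * m + 1) = (S m + S (m + 1)) / (S (m + 1) + S (m + 2)) := by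
  have hl := h.one_lt
  induction m with
  | zero =>
    have := h.one
    simp only [height, h.zero, h.second, zero_add]
    field_simp
    ring
  | succ m ih =>
    have h1 := h.succ_pos m (by omega)
    have h2 := h.succ_pos (m + 1) (by omega)
    have e : height l (2 * (m + 1) + 1) = 1 / (l - height l (2 * m + 1)) := by
      rw [show 2 * (m + 1) + 1 = 2 * m + 1 + 2 by ring, height]
    have h3 := h.step m
    have h4 := h.step (m + 1)
    rw [e, ih (by omega)]
    have : l - (S m + S (m + 1)) / (S (m + 1) + S (m + 2))
        = (S (m + 2) + S (m + 3)) / (S (m + 1) + S (m + 2)) := by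
      have : S (m + 1) + S (m + 2) ≠ 0 := by positivity
      rw [h4]
      field_simp
      linear_combination -h3
    rw [this, one_div_div]

theorem height_lt_succ_even (h : SineSeq r l S) (m : ℕ) (hm : m ≤ r) :
    height l (2 * m) < height l (2 * m + 1) := by
  have h1 := h.succ_pos m (by omega)
  have h2 := h.succ_pos (m + 1) (by omega)
  have h3 := h.sq_sub m
  have h4 := h.one
  rw [h.height_even m (by omega), h.height_odd m (by omega),
    div_lt_div_iff₀ h1 (by positivity)]
  nlinarith [pow_pos h4 2]

theorem height_lt_succ_odd (h : SineSeq r l S) (m : ℕ) (hm : m ≤ r) :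
    height l (2 * m + 1) < height l (2 * m + 2) := by
  have h1 := h.succ_pos m (by omega)
  have h2 := h.succ_pos (m + 1) (by omega)
  have h3 := h.sq_sub m
  have h4 := h.one
  rw [h.height_odd m (by omega), show 2 * m + 2 = 2 * (m + 1) by ring,
    h.height_even (m + 1) (by omega), div_lt_div_iff₀ (by positivity) h2]
  nlinarith [pow_pos h4 2]

theorem height_lt_succ (h : SineSeq r l S) (m : ℕ) (hm : m ≤ 2 * r + 1) :
    height l m < height l (m + 1) := by
  rcases Nat.even_or_odd' m with ⟨j, rfl | rfl⟩
  · exact h.height_lt_succ_even j (by omega)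
  · exact h.height_lt_succ_odd j (by omega)

theorem height_le (h : SineSeq r l S) {m n : ℕ} (hmn : m ≤ n) (hn : n ≤ 2 * r + 2) :
    height l m ≤ height l n := by
  induction n, hmn using Nat.le_induction with
  | base => exact le_rfl
  | succ n _ ih => exact (ih (by omega)).trans (h.height_lt_succ n (by omega)).le

theorem height_top (h : SineSeq r l S) : height l (2 * r + 3) = 1 := by
  have h1 := h.step (r + 1)
  have hl := h.one_lt
  rw [show 2 * r + 3 = 2 * (r + 1) + 1 by ring, h.height_odd (r + 1) (by omega), h1, h.top, h.pre]
  rw [div_eq_one_iff_eq (by linarith)]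
  ring

theorem height_pre (h : SineSeq r l S) : height l (2 * r + 2) = l / 2 := by
  rw [show 2 * r + 2 = 2 * (r + 1) by ring, h.height_even (r + 1) (by omega), h.top, h.pre]
  simp

theorem height_base (h : SineSeq r l S) : height l (2 * r + 1) = l - 1 := by
  have hl := h.one_lt
  rw [h.height_odd r (by omega), h.top, h.pre, h.prepre]
  field_simp
  ring

theorem height_lt_one (h : SineSeq r l S) (n : ℕ) (hn : n ≤ 2 * r + 2) : height l n < 1 := by
  have := h.height_le hn le_rfl
  rw [h.height_pre] at this
  linarith [h.lt_two]

theorem height_nonneg (h : SineSeq r l S) (n : ℕ) (hn : n ≤ 2 * r + 2) : 0 ≤ height l n := by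
  have := h.height_le (Nat.zero_le n) hn
  simpa [height] using this

end SineSeq

/-- The affine form whose zero is the image of `1 / c - l` under `m` iterates of
`t ↦ -1 / t - l`. -/
def form (S : ℕ → ℝ) (c : ℝ) (m : ℕ) (t : ℝ) : ℝ :=
  (c * S (m + 1) - S m) * t + (c * S (m + 2) - S (m + 1))

namespace SineSeq

variable {r : ℕ} {l : ℝ} {S : ℕ → ℝ}

theorem form_zero (h : SineSeq r l S) (c t : ℝ) :
    form S c 0 t = S 1 * (c * (t + l) - 1) := by
  simp only [form, h.zero, h.second, zero_add]; ring

theorem form_succ (h : SineSeq r l S) (c : ℝ) (m : ℕ) {t : ℝ} (ht : t ≠ 0) :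
    form S c (m + 1) (-1 / t - l) = -1 / t * form S c m t := by
  simp only [form, h.step m, h.step (m + 1)]; field_simp; ring

theorem form_last (h : SineSeq r l S) (c t : ℝ) :
    form S c r t = (c * l / 2 - l ^ 2 / 2 + 1) * t + (c - l / 2) := by
  simp only [form, h.top, h.pre, h.prepre]; ring

/-- Positivity of the slopes of `form`. -/
theorem coeff_pos (h : SineSeq r l S) {c : ℝ} (hc : l / 2 ≤ c) (m : ℕ) (hm : m ≤ r) :
    0 < c * S (m + 1) - S m := by
  have h1 := h.succ_pos m (by omega)
  have h2 := h.mono m (by omega)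
  have h3 := h.mono (m + 1) (by omega)
  have h4 := h.step m
  -- For c = λ/2 the slope is half of S (m + 2) - S m.
  nlinarith

/-- For c = λ - 1 the slope is S (m + 2) - S (m + 1). This weaker bound on c covers (1 - α)λ when αλ
≤ 1. -/
theorem coeff_pos' (h : SineSeq r l S) {c : ℝ} (hc : l - 1 ≤ c) (m : ℕ) (hm : m ≤ r) :
    0 < c * S (m + 1) - S m := by
  have h1 := h.succ_pos m (by omega)
  have h3 := h.mono (m + 1) (by omega)
  have h4 := h.step m
  nlinarith

end SineSeq

end AlphaRosen

/-! ### Digits, and the invariant region of the natural extension -/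

namespace AlphaRosen

variable {l α : ℝ}

theorem sign_div_neg {t : ℝ} (hl : 0 < l) (ht : t < 0) : |1 / (l * t)| = -1 / t / l := by
  rw [abs_of_neg (one_div_neg.mpr (mul_neg_of_pos_of_neg hl ht))]
  field_simp

theorem digit_of_neg {t : ℝ} (hl : 0 < l) (ht : t < 0) :
    digit l α t = ⌊-1 / t / l + 1 - α⌋ := by
  rw [digit, sign_div_neg hl ht]

theorem digit_of_pos {t : ℝ} (hl : 0 < l) (ht : 0 < t) :
    digit l α t = ⌊1 / t / l + 1 - α⌋ := by
  rw [digit, abs_of_pos (by positivity)]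
  congr 3; field_simp

theorem T_eq {t : ℝ} (hl : 0 < l) (ht : t ≠ 0) :
    T l α t = Real.sign t / t - l * (digit l α t : ℤ) := by
  rw [T, if_neg ht]
  rcases lt_or_gt_of_ne ht with h | h
  · rw [digit_of_neg hl h, Real.sign_of_neg h, div_div, mul_comm t l]
  · rw [digit_of_pos hl h, Real.sign_of_pos h, div_div, mul_comm t l]

theorem T_of_neg {t : ℝ} (hl : 0 < l) (ht : t < 0) :
    T l α t = -1 / t - l * (digit l α t : ℤ) := by
  rw [T_eq hl ht.ne, Real.sign_of_neg ht]

theorem T_of_pos {t : ℝ} (hl : 0 < l) (ht : 0 < t) :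
    T l α t = 1 / t - l * (digit l α t : ℤ) := by
  rw [T_eq hl ht.ne', Real.sign_of_pos ht]

theorem sub_floor_mem (hl : 0 < l) (z : ℝ) :
    (α - 1) * l ≤ z - l * (⌊z / l + 1 - α⌋ : ℤ) ∧ z - l * (⌊z / l + 1 - α⌋ : ℤ) < α * l := by
  have h1 := Int.floor_le (z / l + 1 - α)
  have h2 := Int.lt_floor_add_one (z / l + 1 - α)
  have h3 : z = z / l * l := by field_simp
  constructor <;> nlinarith

theorem T_mem (hl : 0 < l) (h0 : 0 < α) (h1 : α ≤ 1) (t : ℝ) :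
    (α - 1) * l ≤ T l α t ∧ T l α t < α * l := by
  by_cases h : t = 0
  · simp only [T, h, if_true]
    constructor <;> nlinarith
  · rw [T, if_neg h, mul_comm l t, ← div_div]
    exact sub_floor_mem hl _

theorem fracPart_mem (hl : 0 < l) (x : ℝ) :
    (α - 1) * l ≤ fracPart l α x ∧ fracPart l α x < α * l := by
  have := sub_floor_mem (α := α) hl x
  rwa [mul_comm l (⌊x / l + 1 - α⌋ : ℝ)] at this

theorem digit_neg_iff {t : ℝ} (hl : 0 < l) (ht : t < 0) (n : ℤ) :
    digit l α t = n ↔ (n - 1 + α) * l ≤ -1 / t ∧ -1 / t < (n + α) * l := by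
  have h3 : -1 / t = -1 / t / l * l := by field_simp
  rw [digit_of_neg hl ht, Int.floor_eq_iff]
  generalize -1 / t / l = w at h3
  rw [h3]
  constructor
  · rintro ⟨h1, h2⟩
    constructor
    · apply mul_le_mul_of_nonneg_right _ hl.le; linarith
    · apply mul_lt_mul_of_pos_right _ hl; linarith
  · rintro ⟨h1, h2⟩
    have := le_of_mul_le_mul_right h1 hl
    have := lt_of_mul_lt_mul_right h2 hl.le
    constructor <;> linarith

/-- The product of αλ and (1 - α)λ is at most λ²/4 < 1. -/
theorem mul_le_neg_inv (hl : 0 < l) (hl2 : l < 2) (h0 : 1 / 2 ≤ α) {t : ℝ}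
    (ht : t < 0) (hm : (α - 1) * l ≤ t) : α * l ≤ -1 / t := by
  rw [le_div_iff_of_neg ht]
  have h3 : -t * (α * l) ≤ (1 - α) * l * (α * l) := by
    apply mul_le_mul_of_nonneg_right <;> nlinarith
  have h4 : (1 - α) * α ≤ 1 / 4 := by nlinarith [sq_nonneg (α - 1 / 2)]
  have h5 : l * l ≤ 4 := by nlinarith
  nlinarith [mul_self_nonneg l]

theorem one_le_digit_of_neg (hl : 0 < l) (hl2 : l < 2) (h0 : 1 / 2 ≤ α) {t : ℝ}
    (ht : t < 0) (hm : (α - 1) * l ≤ t) : 1 ≤ digit l α t := by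
  rw [digit_of_neg hl ht, Int.le_floor]
  push_cast
  have h3 : α ≤ -1 / t / l := by
    rw [le_div_iff₀ hl]; exact mul_le_neg_inv hl hl2 h0 ht hm
  linarith

theorem digit_eq_one (hl : 0 < l) (hl2 : l < 2) (h0 : 1 / 2 ≤ α) {t : ℝ}
    (ht : t < 0) (hm : (α - 1) * l ≤ t) (hz : -1 / t < (1 + α) * l) : digit l α t = 1 := by
  rw [digit_neg_iff hl ht]
  push_cast
  exact ⟨by simpa using mul_le_neg_inv hl hl2 h0 ht hm, hz⟩

theorem one_le_digit_of_pos (hl : 0 < l) (h1 : α * l ≤ 1) {t : ℝ}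
    (ht : 0 < t) (hm : t ≤ α * l) : 1 ≤ digit l α t := by
  rw [digit_of_pos hl ht, Int.le_floor]
  push_cast
  have h3 : α ≤ 1 / t / l := by
    rw [le_div_iff₀ hl, le_div_iff₀ ht]
    nlinarith
  linarith

theorem natExt_of_neg {t : ℝ} (ht : t < 0) (v : ℝ) :
    natExt l α (t, v) = (T l α t, 1 / (digit l α t * l - v)) := by
  simp only [natExt, Real.sign_of_neg ht]; congr 2; ring

theorem natExt_of_pos {t : ℝ} (ht : 0 < t) (v : ℝ) :
    natExt l α (t, v) = (T l α t, 1 / (digit l α t * l + v)) := by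
  simp only [natExt, Real.sign_of_pos ht]; congr 2; ring

/-- Division by zero returns 0 here, in the digit as well as in the second coordinate. -/
theorem natExt_zero (h0 : 0 < α) (h1 : α ≤ 1) (v : ℝ) : natExt l α (0, v) = (0, 0) := by
  have : ⌊1 - α⌋ = 0 := by rw [Int.floor_eq_zero_iff]; constructor <;> simp <;> linarith
  simp [natExt, T, digit, Real.sign_zero, this]

/-- `a < b`, with equality also allowed when `s` holds. -/
def WeakLT (s : Prop) (a b : ℝ) : Prop := a < b ∨ (s ∧ a = b)

theorem WeakLT.le {s : Prop} {a b : ℝ} (h : WeakLT s a b) : a ≤ b := by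
  rcases h with h | ⟨_, h⟩
  · exact h.le
  · exact h.le

/-- The region that contains the orbits of the natural extension; `st` and `sv` decide which
boundary points belong to it. -/
structure Inv (r : ℕ) (l α : ℝ) (S : ℕ → ℝ) (st sv : Prop) (t v : ℝ) : Prop where
  left : (α - 1) * l ≤ t
  right : t < α * l
  nonneg : 0 ≤ v
  le_one : v ≤ 1
  -- For α < 1/λ the forms vanish at r_{m+1} (here) and at l_{m+1} (next field), so the two fields
  -- encode the heights of `Omega`. Stated through forms, they also make sense for α = 1/λ.
  odd : ∀ m ≤ r, WeakLT st (form S (α * l) m t) 0 → WeakLT sv v (height l (2 * m + 1))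
  even : ∀ m ≤ r, form S ((1 - α) * l) m t < 0 → v ≤ height l (2 * m + 2)

variable {r : ℕ} {S : ℕ → ℝ} {st sv : Prop}

namespace SineSeq

theorem Inv_of_lt_height_one (h : SineSeq r l S) {t v : ℝ} (h1 : (α - 1) * l ≤ t)
    (h2 : t < α * l) (h3 : 0 ≤ v) (h4 : WeakLT sv v (1 / (l + 1))) :
    Inv r l α S st sv t v := by
  have e : height l 1 = 1 / (l + 1) := by simp [height]
  rw [← e] at h4
  refine ⟨h1, h2, h3, h4.le.trans (h.height_lt_one 1 (by omega)).le, ?_, ?_⟩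
  · intro m hm _
    have := h.height_le (m := 1) (n := 2 * m + 1) (by omega) (by omega)
    rcases Nat.eq_zero_or_pos m with rfl | hm0
    · exact h4
    · have := h.height_lt_succ_odd 0 (by omega)
      have := h.height_le (m := 2) (n := 2 * m + 1) (by omega) (by omega)
      exact Or.inl (by linarith [h4.le])
  · intro m hm _
    exact h4.le.trans (h.height_le (by omega) (by omega))

theorem Inv_of_le_height_two (h : SineSeq r l S) {t v : ℝ} (h1 : (α - 1) * l ≤ t)
    (h2 : t < α * l) (h3 : 0 ≤ v) (h4 : v ≤ 1 / l)
    (h5 : ¬ WeakLT st (form S (α * l) 0 t) 0) : Inv r l α S st sv t v := by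
  have e : height l 2 = 1 / l := by simp [height]
  rw [← e] at h4
  refine ⟨h1, h2, h3, h4.trans (h.height_lt_one 2 (by omega)).le, ?_, ?_⟩
  · intro m hm hf
    rcases Nat.eq_zero_or_pos m with rfl | hm0
    · exact absurd hf h5
    · have := h.height_lt_succ (2 * m) (by omega)
      have := h.height_le (m := 2) (n := 2 * m) (by omega) (by omega)
      exact Or.inl (by linarith)
  · intro m hm _
    exact h4.trans (h.height_le (by omega) (by omega))

/-- After a digit `-2`, being left of `r₁` requires being left of `r_{p-1}` before. -/
theorem form_last_of_form_zero (h : SineSeq r l S) (h0 : 1 / 2 ≤ α) (h1 : α * l ≤ 1)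
    {t : ℝ} (ht : t < 0) (hf : WeakLT st (form S (α * l) 0 (-1 / t - l * 2)) 0) :
    WeakLT st (form S (α * l) r t) 0 := by
  have hl := h.one_lt
  have hl2 := h.lt_two
  rw [h.form_zero] at hf
  rw [h.form_last]
  have hS := h.one
  have hA : 0 < α * l * l / 2 - l ^ 2 / 2 + 1 := by nlinarith
  have key : α * l * (-1 - l * t) - t = (α * l * (-1 / t - l * 2 + l) - 1) * t := by
    have : -1 / t * t = -1 := div_mul_cancel₀ (-1) ht.ne
    linear_combination (-(α * l)) * this
  have h3 : 0 ≤ 1 - α ^ 2 * l ^ 2 := by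
    have : 0 ≤ α * l := by nlinarith
    nlinarith
  have hB : 0 < 1 + α * l ^ 2 := by positivity
  -- Compares -αλ/(1 + αλ²), the preimage of r₁ under digit -2, with the zero r_{p-1} of the last
  -- form; the remainder has the right sign because αλ ≤ 1.
  have id : (1 + α * l ^ 2) * ((α * l * l / 2 - l ^ 2 / 2 + 1) * t + (α * l - l / 2))
      = (α * l * l / 2 - l ^ 2 / 2 + 1) * (α * l + (1 + α * l ^ 2) * t)
        - l / 2 * (1 - α ^ 2 * l ^ 2) := by ring
  have hX : 0 ≤ α * l * (-1 - l * t) - t := by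
    rw [key]
    have : α * l * (-1 / t - l * 2 + l) - 1 ≤ 0 := by
      by_contra hc
      have := hf.le
      push Not at hc
      nlinarith [mul_pos hS hc]
    nlinarith
  rcases hf with hf | ⟨hs, hf⟩
  · left
    have hf' : α * l * (-1 / t - l * 2 + l) - 1 < 0 := by
      by_contra hc
      push Not at hc
      nlinarith [mul_nonneg hS.le hc]
    have : 0 < α * l * (-1 - l * t) - t := by rw [key]; nlinarith
    have : (α * l * l / 2 - l ^ 2 / 2 + 1) * (α * l + (1 + α * l ^ 2) * t) < 0 := by
      apply mul_neg_of_pos_of_neg hA; nlinarith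
    by_contra hc
    push Not at hc
    nlinarith [mul_nonneg hB.le hc]
  · have h6 : (α * l * l / 2 - l ^ 2 / 2 + 1) * (α * l + (1 + α * l ^ 2) * t) ≤ 0 := by
      apply mul_nonpos_of_nonneg_of_nonpos hA.le; nlinarith
    have h7 : (α * l * l / 2 - l ^ 2 / 2 + 1) * t + (α * l - l / 2) ≤ 0 := by
      by_contra hc
      push Not at hc
      nlinarith [mul_pos hB hc]
    rcases h7.lt_or_eq with h7 | h7
    · exact Or.inl h7
    · exact Or.inr ⟨hs, h7⟩

/-- A point with digit `-1` lies left of `r_{p-1}`. -/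
theorem form_last_neg (h : SineSeq r l S) (h0 : 1 / 2 ≤ α) (h1 : α * l ≤ 1)
    {t : ℝ} (ht : t < 0) (hz : -1 / t < (1 + α) * l) : form S (α * l) r t < 0 := by
  have hl := h.one_lt
  have hl2 := h.lt_two
  rw [h.form_last]
  have hA : 0 < α * l * l / 2 - l ^ 2 / 2 + 1 := by nlinarith
  rw [div_lt_iff_of_neg ht] at hz
  have hP : 0 < (1 + α) * l := by positivity
  have h3 : 0 ≤ 1 - α ^ 2 * l ^ 2 := by
    have : 0 ≤ α * l := by nlinarith
    nlinarith
  -- Compares -δ₁ with r_{p-1}; again the remainder 1 - α²λ² decides.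
  have id : (1 + α) * l * ((α * l * l / 2 - l ^ 2 / 2 + 1) * t + (α * l - l / 2))
     = (α * l * l / 2 - l ^ 2 / 2 + 1) * ((1 + α) * l * t + 1) - (1 - α ^ 2 * l ^ 2) := by ring
  have : (α * l * l / 2 - l ^ 2 / 2 + 1) * ((1 + α) * l * t + 1) < 0 := by
    apply mul_neg_of_pos_of_neg hA; nlinarith
  by_contra hc
  push Not at hc
  nlinarith [mul_nonneg hP.le hc]

theorem form_left_last_neg (h : SineSeq r l S) (h0 : 1 / 2 ≤ α) (h1 : α * l ≤ 1)
    {t : ℝ} (ht : t < 0) : form S ((1 - α) * l) r t < 0 := by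
  have hl := h.one_lt
  have hl2 := h.lt_two
  rw [h.form_last]
  have hA : 0 < (1 - α) * l * l / 2 - l ^ 2 / 2 + 1 := by nlinarith
  have : (1 - α) * l - l / 2 ≤ 0 := by nlinarith
  nlinarith

theorem WeakLT_inv_sub {s : Prop} {v H c : ℝ} (hv : WeakLT s v H) (hc : H < c) :
    WeakLT s (1 / (c - v)) (1 / (c - H)) := by
  rcases hv with hv | ⟨hs, rfl⟩
  · exact Or.inl (one_div_lt_one_div_of_lt (by linarith) (by linarith))
  · exact Or.inr ⟨hs, rfl⟩

/-- Under digit -1 the forms advance from m to m + 1 and the heights from H_n to H_{n+2}, so the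
constraints carry over. Every other digit gives a new v of at most H₂, and of at most H₁ unless the
image is right of r₁. -/
theorem Inv_natExt (h : SineSeq r l S) (h0 : 1 / 2 ≤ α) (h1 : α * l ≤ 1)
    (hst : st → 1 / 2 < α) {t v : ℝ} (hI : Inv r l α S st sv t v) :
    Inv r l α S st sv (natExt l α (t, v)).1 (natExt l α (t, v)).2 := by
  have hl := h.one_lt
  have hl0 : 0 < l := by linarith
  have hl2 := h.lt_two
  have hα1 : α < 1 := by nlinarith
  have hS := h.one
  have hv0 := hI.nonneg
  have hv1 := hI.le_one
  obtain ⟨hT1, hT2⟩ := T_mem hl0 (by linarith) hα1.le t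
  rcases lt_trichotomy t 0 with ht | rfl | ht
  · rw [natExt_of_neg ht]
    have hd := one_le_digit_of_neg hl0 hl2 h0 ht hI.left
    obtain ⟨hz1, hz2⟩ := (digit_neg_iff hl0 ht (digit l α t)).1 rfl
    have hTe := T_of_neg (α := α) hl0 ht
    generalize hD : digit l α t = D at *
    have hcase : D = 1 ∨ D = 2 ∨ 3 ≤ D := by omega
    rcases hcase with rfl | rfl | hD3
    · have hfl : form S (α * l) r t < 0 :=
        h.form_last_neg h0 h1 ht (by push_cast at hz2; exact hz2)
      have hvl : WeakLT sv v (l - 1) := h.height_base ▸ hI.odd r le_rfl (Or.inl hfl)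
      have hvl' := hvl.le
      rw [hTe] at hT1 hT2 ⊢
      simp only [Int.cast_one, mul_one, one_mul] at hT1 hT2 ⊢
      have hzl : 1 / ((1 - α) * l) ≤ -1 / t := by
        rw [div_le_iff₀ (by nlinarith), div_mul_eq_mul_div, le_div_iff_of_neg ht]
        nlinarith [hI.left]
      have hzl' : 1 ≤ (1 - α) * l * (-1 / t) := by
        rw [div_le_iff₀ (by nlinarith)] at hzl; linarith
      have hzp : 0 < -1 / t := div_pos_of_neg_of_neg (by norm_num) ht
      refine ⟨hT1, hT2, by apply one_div_nonneg.mpr; linarith, ?_, ?_, ?_⟩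
      · rw [div_le_one (by linarith)]; linarith
      · intro m hm hf
        cases m with
        | zero =>
          -- Digit -1 sends t ≥ l₀ to a point at or beyond l₁, which is right of r₁, strictly if α >
          -- 1/2. For α = 1/2 the points l₁ and r₁ coincide; hence the hypothesis `hst`.
          exfalso
          rw [h.form_zero] at hf
          rcases hf with hf | ⟨hs, hf⟩
          · have : α * l * (-1 / t - l + l) - 1 < 0 := by
              by_contra hc; push Not at hc; nlinarith [mul_nonneg hS.le hc]
            have : 0 ≤ (2 * α - 1) * l * (-1 / t) := by
              apply mul_nonneg (mul_nonneg _ _) hzp.le <;> linarith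
            nlinarith
          · have : α * l * (-1 / t - l + l) - 1 = 0 := by
              rcases mul_eq_zero.1 hf with h' | h'
              · exact absurd h' hS.ne'
              · exact h'
            have : 0 < (2 * α - 1) * l * (-1 / t) := by
              have := hst hs
              apply mul_pos (mul_pos _ _) hzp <;> linarith
            nlinarith
        | succ m =>
          rw [h.form_succ _ _ ht.ne] at hf
          have hf' : WeakLT st (form S (α * l) m t) 0 := by
            rcases hf with hf | ⟨hs, hf⟩
            · left; by_contra hc; push Not at hc; nlinarith [mul_nonneg hzp.le hc]
            · right
              rcases mul_eq_zero.1 hf with h' | h'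
              · exact absurd h' hzp.ne'
              · exact ⟨hs, h'⟩
          have := hI.odd m (by omega) hf'
          rw [show 2 * (m + 1) + 1 = 2 * m + 1 + 2 by ring, height]
          exact WeakLT_inv_sub this (by linarith [h.height_lt_one (2 * m + 1) (by omega)])
      · intro m hm hf
        cases m with
        | zero =>
          exfalso
          rw [h.form_zero] at hf
          have : (1 - α) * l * (-1 / t - l + l) - 1 < 0 := by
            by_contra hc; push Not at hc; nlinarith [mul_nonneg hS.le hc]
          nlinarith
        | succ m =>
          rw [h.form_succ _ _ ht.ne] at hf
          have hf' : form S ((1 - α) * l) m t < 0 := by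
            by_contra hc; push Not at hc; nlinarith [mul_nonneg hzp.le hc]
          have := hI.even m (by omega) hf'
          rw [show 2 * (m + 1) + 2 = 2 * m + 2 + 2 by ring, height]
          have := h.height_lt_one (2 * m + 2) (by omega)
          exact one_div_le_one_div_of_le (by linarith) (by linarith)
    · rw [hTe] at hT1 hT2 ⊢
      simp only [Int.cast_ofNat] at hT1 hT2 ⊢
      by_cases hf : WeakLT st (form S (α * l) 0 (-1 / t - l * 2)) 0
      · have hf2 := h.form_last_of_form_zero h0 h1 ht hf
        have hvl : WeakLT sv v (l - 1) := h.height_base ▸ hI.odd r le_rfl hf2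
        refine h.Inv_of_lt_height_one hT1 hT2 (one_div_nonneg.mpr (by linarith)) ?_
        have := WeakLT_inv_sub (c := 2 * l) hvl (by linarith)
        rwa [show 2 * l - (l - 1) = l + 1 by ring] at this
      · refine h.Inv_of_le_height_two hT1 hT2 (one_div_nonneg.mpr (by linarith)) ?_ hf
        exact one_div_le_one_div_of_le (by linarith) (by linarith)
    · have hD' : (3 : ℝ) ≤ D := by exact_mod_cast hD3
      refine h.Inv_of_lt_height_one hT1 hT2 (one_div_nonneg.mpr (by nlinarith)) (Or.inl ?_)
      exact one_div_lt_one_div_of_lt (by linarith) (by nlinarith)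
  · rw [natExt_zero (by linarith) hα1.le]
    refine h.Inv_of_lt_height_one (by nlinarith) (by nlinarith) le_rfl (Or.inl ?_)
    exact one_div_pos.mpr (by linarith)
  · rw [natExt_of_pos ht]
    have hd := one_le_digit_of_pos hl0 h1 ht hI.right.le
    have hTe := T_of_pos (α := α) hl0 ht
    generalize hD : digit l α t = D at *
    have hcase : D = 1 ∨ 2 ≤ D := by omega
    rcases hcase with rfl | hD2
    · simp only [Int.cast_one, one_mul]
      refine h.Inv_of_le_height_two hT1 hT2 (one_div_nonneg.mpr (by linarith)) ?_ ?_
      · exact one_div_le_one_div_of_le (by linarith) (by linarith)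
      · intro hf
        rw [hTe, h.form_zero] at hf
        have h2 : 1 < α * l * (1 / t) := by
          rw [mul_one_div, lt_div_iff₀ ht]; linarith [hI.right]
        have : 0 < S 1 * (α * l * (1 / t - l * ((1 : ℤ) : ℝ) + l) - 1) := by
          apply mul_pos hS; push_cast; linarith
        linarith [hf.le]
    · have hD' : (2 : ℝ) ≤ D := by exact_mod_cast hD2
      refine h.Inv_of_lt_height_one hT1 hT2 (one_div_nonneg.mpr (by nlinarith)) (Or.inl ?_)
      exact one_div_lt_one_div_of_lt (by linarith) (by nlinarith)

end SineSeq

end AlphaRosen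

/-! ### Runs of digits -1 and the backward iterates -/

namespace AlphaRosen

variable {r : ℕ} {l α : ℝ} {S : ℕ → ℝ} {st sv : Prop}

/-- The slope of `form S c m`. -/
def slope (S : ℕ → ℝ) (c : ℝ) (m : ℕ) : ℝ := c * S (m + 1) - S m

theorem form_eq_slope (S : ℕ → ℝ) (c : ℝ) (m : ℕ) (t : ℝ) :
    form S c m t = slope S c m * t + slope S c (m + 1) := rfl

namespace SineSeq

theorem slope_step (h : SineSeq r l S) (c : ℝ) (m : ℕ) :
    slope S c (m + 2) = l * slope S c (m + 1) - slope S c m := by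
  simp only [slope, h.step m, h.step (m + 1)]; ring

theorem slope_zero (h : SineSeq r l S) (c : ℝ) : slope S c 0 = c * S 1 := by
  simp [slope, h.zero]

theorem slope_one (h : SineSeq r l S) (c : ℝ) : slope S c 1 = (c * l - 1) * S 1 := by
  simp only [slope, one_add_one_eq_two, h.second]; ring

theorem slope_last (h : SineSeq r l S) (c : ℝ) : slope S c r = c * l / 2 - l ^ 2 / 2 + 1 := by
  rw [slope, h.pre, h.prepre]; ring

theorem slope_top (h : SineSeq r l S) (c : ℝ) : slope S c (r + 1) = c - l / 2 := by
  rw [slope, h.pre, h.top]; ring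

/-- The orbit of `1 / c - l` runs through digits `-1` as long as the slopes stay positive. -/
theorem iterate_run (h : SineSeq r l S) (h0 : 1 / 2 ≤ α) (h1 : α * l ≤ 1) {c t : ℝ} (hc : c ≠ 0)
    (hpos : ∀ m ≤ r, 0 < slope S c m) (hlast : -slope S c (r + 1) < α * l * slope S c r)
    (ht : t = 1 / c - l) (htl : (α - 1) * l ≤ t) (m : ℕ) (hm : m ≤ r) :
    (T l α)^[m] t = -slope S c (m + 1) / slope S c m ∧ (α - 1) * l ≤ (T l α)^[m] t ∧
      (m < r → (T l α)^[m] t < 0 ∧ digit l α ((T l α)^[m] t) = 1 ∧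
        (T l α)^[m + 1] t = -1 / (T l α)^[m] t - l) := by
  have hl := h.one_lt
  have hl0 : 0 < l := by linarith
  have hS := h.one
  have aux : ∀ m ≤ r, ∀ s, s = -slope S c (m + 1) / slope S c m → (α - 1) * l ≤ s → m < r →
      s < 0 ∧ digit l α s = 1 ∧ T l α s = -1 / s - l := by
    intro m hm s hs hsl hmr
    have p0 := hpos m hm
    have p1 := hpos (m + 1) hmr
    -- Positive slopes make the point negative; the digit is 1 because the next iterate stays below
    -- αλ.
    have hs0 : s < 0 := by rw [hs]; exact div_neg_of_neg_of_pos (by linarith) p0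
    have hz : -1 / s - l = -slope S c (m + 2) / slope S c (m + 1) := by
      rw [hs, h.slope_step]; field_simp; ring
    have hz2 : -slope S c (m + 2) / slope S c (m + 1) < α * l := by
      rw [div_lt_iff₀ p1]
      rcases (Nat.succ_le_of_lt hmr).lt_or_eq with h' | h'
      · have p2 := hpos (m + 2) h'
        have : 0 < α * l * slope S c (m + 1) := by apply mul_pos (mul_pos _ hl0) p1; linarith
        linarith
      · rw [show m + 2 = r + 1 by omega, show m + 1 = r by omega]; exact hlast
    have hd := digit_eq_one hl0 h.lt_two h0 hs0 hsl (by linarith)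
    refine ⟨hs0, hd, ?_⟩
    rw [T_of_neg hl0 hs0, hd]; simp
  induction m with
  | zero =>
    have hs : t = -slope S c 1 / slope S c 0 := by
      rw [h.slope_zero, h.slope_one, ht]; field_simp; ring
    exact ⟨hs, htl, aux 0 hm t hs htl⟩
  | succ m ih =>
    obtain ⟨i1, i2, i3⟩ := ih (by omega)
    obtain ⟨j1, j2, j3⟩ := i3 (by omega)
    have p0 := hpos m (by omega)
    have p1 := hpos (m + 1) (by omega)
    have hs : (T l α)^[m + 1] t = -slope S c (m + 2) / slope S c (m + 1) := by
      rw [j3, i1, h.slope_step]; field_simp; ring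
    have hsl : (α - 1) * l ≤ (T l α)^[m + 1] t := by
      rw [Function.iterate_succ_apply']
      exact (T_mem hl0 (by linarith) (by nlinarith) _).1
    refine ⟨hs, hsl, fun hmr => ?_⟩
    rw [Function.iterate_succ_apply' (T l α) (m + 1)]
    exact aux (m + 1) hm _ hs hsl hmr

/-- A digit `-2` followed by `p - 2` digits `-1`, read in the coordinate `y = -1 / t - l`. -/
theorem block_rel (h : SineSeq r l S) {t : ℕ → ℝ} {y z : ℝ} (h0 : t 0 = y - l)
    (hs : ∀ i < r, t i ≠ 0 ∧ t (i + 1) = -1 / t i - l) (hz : z ≠ 0) (hr : t r = -1 / z) :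
    (z - l) * (2 - l * y) = 2 * y - l := by
  -- The i-th point as a quotient of combinations of sines, with the denominator cleared since it is
  -- not known to be nonzero.
  have key : ∀ i ≤ r, t i * (S (i + 1) - S i * y) = -(S (i + 2) - S (i + 1) * y) := by
    intro i
    induction i with
    | zero => intro _; rw [h0, h.zero, zero_add, h.second]; ring
    | succ i ih =>
      intro hi
      obtain ⟨h2, h3⟩ := hs i (by omega)
      have h4 := ih (by omega)
      have h5 : -1 / t i * t i = -1 := div_mul_cancel₀ _ h2
      rw [h3, h.step (i + 1)]
      linear_combination -(S (i + 1) - S i * y) * h5 + (-1 / t i) * h4 - y * h.step i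
  have := key r le_rfl
  rw [hr, h.top, h.pre, h.prepre] at this
  field_simp at this
  linear_combination this

end SineSeq

/-- The coordinates of the backward iterates: `τ_k = -1 / (l + y_k)`, where
`ρ_k = (1 - y_k) / (1 + y_k)` is geometric. -/
noncomputable def rho (l β : ℝ) (k : ℕ) : ℝ := ((2 - l) / (2 + l)) ^ k * ((1 - β * l) / (1 + β * l))

/-- See `rho`. -/
noncomputable def ycoord (l β : ℝ) (k : ℕ) : ℝ := (1 - rho l β k) / (1 + rho l β k)

/-- The first coordinates of the backward iterates. -/
noncomputable def tau (l β : ℝ) (k : ℕ) : ℝ := -1 / (l + ycoord l β k)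

section rho
variable {β : ℝ}

theorem rho_pos (hl1 : 1 < l) (hl2 : l < 2) (h0 : 1 / 2 ≤ β) (h1 : β * l < 1) (k : ℕ) :
    0 < rho l β k := by
  have : 0 < β * l := by nlinarith
  have h2 : 0 < 1 - β * l := by linarith
  have h3 : 0 < 2 - l := by linarith
  unfold rho; positivity

theorem rho_succ (k : ℕ) : rho l β (k + 1) = (2 - l) / (2 + l) * rho l β k := by
  unfold rho; ring

theorem rho_succ_lt (hl1 : 1 < l) (hl2 : l < 2) (h0 : 1 / 2 ≤ β) (h1 : β * l < 1) (k : ℕ) :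
    rho l β (k + 1) < rho l β k := by
  rw [rho_succ]
  have h2 := rho_pos hl1 hl2 h0 h1 k
  have : (2 - l) / (2 + l) < 1 := by rw [div_lt_one (by linarith)]; linarith
  nlinarith

theorem rho_le_zero (hl1 : 1 < l) (hl2 : l < 2) (h0 : 1 / 2 ≤ β) (h1 : β * l < 1) (k : ℕ) :
    rho l β k ≤ rho l β 0 := by
  induction k with
  | zero => exact le_rfl
  | succ k ih => exact (rho_succ_lt hl1 hl2 h0 h1 k).le.trans ih

theorem tendsto_rho (hl1 : 1 < l) (hl2 : l < 2) : Tendsto (rho l β) atTop (𝓝 0) := by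
  have h1 : 0 ≤ (2 - l) / (2 + l) := div_nonneg (by linarith) (by linarith)
  have h2 : (2 - l) / (2 + l) < 1 := by rw [div_lt_one (by linarith)]; linarith
  have := (tendsto_pow_atTop_nhds_zero_of_lt_one h1 h2).mul_const ((1 - β * l) / (1 + β * l))
  rw [zero_mul] at this
  exact this

theorem ycoord_zero (h : 0 < β * l) : ycoord l β 0 = β * l := by
  simp only [ycoord, rho, pow_zero, one_mul]
  have : 1 + β * l ≠ 0 := by positivity
  have h2 : 1 + (1 - β * l) / (1 + β * l) ≠ 0 := by
    have : 1 + (1 - β * l) / (1 + β * l) = 2 / (1 + β * l) := by field_simp; ring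
    rw [this]; positivity
  rw [div_eq_iff h2]; field_simp; ring

theorem ycoord_lt_one (hl1 : 1 < l) (hl2 : l < 2) (h0 : 1 / 2 ≤ β) (h1 : β * l < 1) (k : ℕ) :
    ycoord l β k < 1 := by
  have := rho_pos hl1 hl2 h0 h1 k
  rw [ycoord, div_lt_one (by linarith)]; linarith

theorem le_ycoord (hl1 : 1 < l) (hl2 : l < 2) (h0 : 1 / 2 ≤ β) (h1 : β * l < 1) (k : ℕ) :
    β * l ≤ ycoord l β k := by
  have h2 : 0 < β * l := by nlinarith
  have := rho_pos hl1 hl2 h0 h1 k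
  rw [← ycoord_zero h2, ycoord, ycoord,
    div_le_div_iff₀ (by linarith [rho_pos hl1 hl2 h0 h1 0]) (by linarith)]
  nlinarith [rho_le_zero hl1 hl2 h0 h1 k]

/-- The relation of `block_rel`, with y_{k+1} before the block and y_k after it; in the coordinate
(1 - y)/(1 + y) it is a multiplication. -/
theorem ycoord_step (hl1 : 1 < l) (hl2 : l < 2) (h0 : 1 / 2 ≤ β) (h1 : β * l < 1) (k : ℕ) :
    ycoord l β k * (2 - l * ycoord l β (k + 1)) = 2 * ycoord l β (k + 1) - l := by
  have p0 := rho_pos hl1 hl2 h0 h1 k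
  have p1 := rho_pos hl1 hl2 h0 h1 (k + 1)
  have e : (2 + l) * rho l β (k + 1) = (2 - l) * rho l β k := by
    rw [rho_succ]; field_simp
  simp only [ycoord]
  generalize rho l β k = a at *
  generalize rho l β (k + 1) = b at *
  field_simp
  linear_combination 2 * e

/-- The reciprocal of c is -1/τ - ν, which equals 1 + y. -/
theorem c_tau (hl1 : 1 < l) (hl2 : l < 2) (h0 : 1 / 2 ≤ β) (h1 : β * l < 1) (k : ℕ) :
    c (tau l β) (fun _ => l - 1) k = (1 + rho l β (k - 1)) / 2 := by
  have p0 := rho_pos hl1 hl2 h0 h1 (k - 1)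
  have p1 := le_ycoord hl1 hl2 h0 h1 (k - 1)
  have h2 : 0 < β * l := by nlinarith
  have p2 : 0 < l + ycoord l β (k - 1) := by linarith
  have e : 1 + tau l β (k - 1) * (l - 1) = (1 + ycoord l β (k - 1)) / (l + ycoord l β (k - 1)) := by
    rw [tau]; field_simp; ring
  have e2 : 1 + ycoord l β (k - 1) = 2 / (1 + rho l β (k - 1)) := by
    rw [ycoord]; field_simp; ring
  simp only [c]
  rw [e, e2, tau]
  field_simp

end rho

namespace SineSeq

theorem tau_facts (h : SineSeq r l S) {β : ℝ} (h0 : 1 / 2 ≤ β) (h1 : β * l < 1) (k : ℕ) :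
    tau l β k < 0 ∧ -1 / tau l β k = l + ycoord l β k := by
  have h2 : 0 < β * l := by nlinarith [h.one_lt]
  have p2 : 0 < l + ycoord l β k := by
    linarith [le_ycoord h.one_lt h.lt_two h0 h1 k, h.one_lt]
  constructor
  · exact div_neg_of_neg_of_pos (by norm_num) p2
  · rw [tau]; field_simp

theorem form_tau_neg (h : SineSeq r l S) {β : ℝ} (h0 : 1 / 2 ≤ β) (h1 : β * l < 1) (k : ℕ) :
    form S (β * l) r (tau l β k) < 0 := by
  have hl := h.one_lt
  have h2 : 0 < β * l := by nlinarith [h.one_lt]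
  have p1 := ycoord_lt_one h.one_lt h.lt_two h0 h1 k
  have p2 : 0 < l + ycoord l β k := by
    linarith [le_ycoord h.one_lt h.lt_two h0 h1 k, h.one_lt]
  rw [h.form_last, tau, mul_div_assoc', ← sub_neg_eq_add, sub_neg, div_lt_iff₀ p2]
  have h3 : 0 ≤ β * l - l / 2 := by nlinarith
  nlinarith [mul_nonneg h3 (sub_pos.2 p1).le, mul_pos (sub_pos.2 h1) (by linarith : 0 < l / 2 + 1)]

/-- `𝒯^{p-1} (τ_{k+1}, l - 1) = (τ_k, l - 1)`. -/
theorem natExt_block (h : SineSeq r l S) {β : ℝ} (h0 : 1 / 2 ≤ β) (h1 : β * l < 1) (k : ℕ) :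
    (natExt l β)^[r + 1] (tau l β (k + 1), l - 1) = (tau l β k, l - 1) := by
  have hl := h.one_lt
  have hl2 := h.lt_two
  have hl0 : 0 < l := by linarith
  have h2 : 0 < β * l := by nlinarith [h.one_lt]
  have p1 := ycoord_lt_one h.one_lt h.lt_two h0 h1 (k + 1)
  have p2 := le_ycoord h.one_lt h.lt_two h0 h1 (k + 1)
  have e := ycoord_step hl hl2 h0 h1 k
  obtain ⟨t1, t2⟩ := h.tau_facts h0 h1 (k + 1)
  set y := ycoord l β (k + 1) with hy
  have y0 : 0 < y := by linarith
  have d2 : digit l β (tau l β (k + 1)) = 2 := by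
    rw [digit_neg_iff hl0 t1, t2]; push_cast; constructor <;> linarith
  have c1 : 1 ≤ 1 / y := by rw [le_div_iff₀ y0]; linarith
  -- After the digit -2 the point is y - λ = 1/c - λ with c = 1/y, so `iterate_run` applies.
  have hpos : ∀ m ≤ r, 0 < slope S (1 / y) m := fun m hm => h.coeff_pos' (by linarith) m hm
  have hlast : -slope S (1 / y) (r + 1) < β * l * slope S (1 / y) r := by
    have := mul_pos h2 (hpos r le_rfl)
    rw [h.slope_top]; linarith
  have first : natExt l β (tau l β (k + 1), l - 1) = (y - l, 1 / (l + 1)) := by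
    rw [natExt_of_neg t1, T_of_neg hl0 t1, d2, t2]
    push_cast
    congr 1
    · ring
    · congr 1; ring
  have run := h.iterate_run (t := y - l) h0 h1.le (one_div_ne_zero y0.ne') hpos hlast (by simp)
    (by nlinarith)
  have iter : ∀ m ≤ r, (natExt l β)^[m] (y - l, 1 / (l + 1)) =
      ((T l β)^[m] (y - l), height l (2 * m + 1)) := by
    intro m
    induction m with
    | zero => intro _; simp [height]
    | succ m ih =>
      intro hm
      obtain ⟨-, -, q⟩ := run m (by omega)
      obtain ⟨q1, q2, q3⟩ := q hm
      rw [Function.iterate_succ_apply', ih (by omega), natExt_of_neg q1, q2,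
        Function.iterate_succ_apply', show 2 * (m + 1) + 1 = 2 * m + 1 + 2 by ring, height]
      simp
  rw [Function.iterate_succ_apply, first, iter r le_rfl, h.height_base, (run r le_rfl).1,
    h.slope_top, h.slope_last]
  congr 1
  have hs := hpos r le_rfl
  rw [h.slope_last] at hs
  have n1 : 0 < 2 - l * y := by nlinarith
  have n2 : 0 < l + ycoord l β k := by linarith [le_ycoord hl hl2 h0 h1 k]
  rw [tau, div_eq_div_iff hs.ne' n2.ne']
  field_simp
  linear_combination -e

theorem natExt_block_iterate (h : SineSeq r l S) {β : ℝ} (h0 : 1 / 2 ≤ β) (h1 : β * l < 1)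
    (k : ℕ) : (natExt l β)^[k * (r + 1)] (tau l β k, l - 1) = (tau l β 0, l - 1) := by
  induction k with
  | zero => simp
  | succ k ih =>
    rw [add_mul, one_mul, Function.iterate_add_apply, h.natExt_block h0 h1, ih]

theorem Inv_iterate (h : SineSeq r l S) (h0 : 1 / 2 ≤ α) (h1 : α * l ≤ 1)
    (hst : st → 1 / 2 < α) {P : ℝ × ℝ} (hI : Inv r l α S st sv P.1 P.2) (n : ℕ) :
    Inv r l α S st sv ((natExt l α)^[n] P).1 ((natExt l α)^[n] P).2 := by
  induction n with
  | zero => exact hI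
  | succ n ih =>
    rw [Function.iterate_succ_apply']
    exact h.Inv_natExt h0 h1 hst ih

/-- The second coordinate gives dλ + εv = λ - H < λ, and with 0 ≤ v ≤ 1 this leaves only ε = -1, d =
1. -/
theorem back_step (h : SineSeq r l S) (h0 : 1 / 2 ≤ α) (h1 : α * l ≤ 1) {t v : ℝ} {i : ℕ}
    (hi : i < r) (hI : Inv r l α S st sv t v)
    (hv : (natExt l α (t, v)).2 = height l (2 * (i + 1) + 1)) :
    t < 0 ∧ digit l α t = 1 ∧ v = height l (2 * i + 1) := by
  have hl := h.one_lt
  have hl0 : 0 < l := by linarith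
  have hH0 := h.height_lt_one (2 * i + 1) (by omega)
  have hH1 := h.height_lt_succ (2 * i) (by omega)
  have hH2 := h.height_nonneg (2 * i) (by omega)
  rw [show 2 * (i + 1) + 1 = 2 * i + 1 + 2 by ring, height] at hv
  have hv0 := hI.nonneg
  have hv1 := hI.le_one
  have inj : ∀ a b : ℝ, 1 / a = 1 / b → a = b := fun a b hab => by simpa using hab
  rcases lt_trichotomy t 0 with ht | rfl | ht
  · have hd := one_le_digit_of_neg hl0 h.lt_two h0 ht hI.left
    rw [natExt_of_neg ht] at hv
    have hv := inj _ _ hv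
    have hd1 : digit l α t = 1 := by
      by_contra hne
      have : (2 : ℝ) ≤ digit l α t := by exact_mod_cast (by omega : (2 : ℤ) ≤ digit l α t)
      nlinarith
    rw [hd1] at hv
    push_cast at hv
    exact ⟨ht, hd1, by linarith⟩
  · rw [natExt_zero (by linarith) (by nlinarith)] at hv
    have : 0 < 1 / (l - height l (2 * i + 1)) := one_div_pos.mpr (by linarith)
    simp only at hv
    linarith
  · have hd := one_le_digit_of_pos hl0 h1 ht hI.right.le
    rw [natExt_of_pos ht] at hv
    have hv := inj _ _ hv
    have : (1 : ℝ) ≤ digit l α t := by exact_mod_cast hd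
    nlinarith

theorem back_run (h : SineSeq r l S) (h0 : 1 / 2 ≤ α) (h1 : α * l ≤ 1)
    (hst : st → 1 / 2 < α) {P : ℝ × ℝ} (hI : Inv r l α S st sv P.1 P.2) (i : ℕ) (hi : i ≤ r)
    (hv : ((natExt l α)^[i] P).2 = height l (2 * i + 1)) :
    P.2 = height l 1 ∧ ∀ j < i, ((natExt l α)^[j] P).1 < 0 ∧
      digit l α ((natExt l α)^[j] P).1 = 1 := by
  induction i with
  | zero => exact ⟨hv, by simp⟩
  | succ i ih =>
    rw [Function.iterate_succ_apply'] at hv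
    obtain ⟨a1, a2, a3⟩ := h.back_step h0 h1 (by omega) (h.Inv_iterate h0 h1 hst hI i) hv
    obtain ⟨b1, b2⟩ := ih (by omega) a3
    refine ⟨b1, fun j hj => ?_⟩
    rcases (Nat.lt_succ_iff.1 hj).lt_or_eq with hj | rfl
    · exact b2 j hj
    · exact ⟨a1, a2⟩

theorem form_iterate (h : SineSeq r l S) {c : ℝ} {t : ℕ → ℝ} {n : ℕ}
    (hs : ∀ i < n, t i < 0 ∧ t (i + 1) = -1 / t i - l) (h0 : 0 < form S c 0 (t 0)) :
    0 < form S c n (t n) := by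
  induction n with
  | zero => exact h0
  | succ n ih =>
    obtain ⟨h2, h3⟩ := hs n (by omega)
    rw [h3, h.form_succ _ _ h2.ne]
    exact mul_pos (div_pos_of_neg_of_neg (by norm_num) h2) (ih fun i hi => hs i (by omega))

/-- `(τ_{k+1}, l - 1)` is the only preimage of `(τ_k, l - 1)` under `𝒯^{p-1}`. -/
theorem back_block (h : SineSeq r l S) {β : ℝ} (h0 : 1 / 2 ≤ β) (h1 : β * l < 1) (k : ℕ)
    {P : ℝ × ℝ} (hI : Inv r l β S False True P.1 P.2)
    (hP : (natExt l β)^[r + 1] P = (tau l β k, l - 1)) : P = (tau l β (k + 1), l - 1) := by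
  have hl := h.one_lt
  have hl2 := h.lt_two
  have hl0 : 0 < l := by linarith
  have hst : False → 1 / 2 < β := False.elim
  obtain ⟨t, v⟩ := P
  have hv0 := hI.nonneg
  have hv1 := hI.le_one
  rw [Function.iterate_succ_apply] at hP
  have hI1 := h.Inv_natExt h0 h1.le hst hI
  obtain ⟨r1, r2⟩ := h.back_run (P := natExt l β (t, v)) h0 h1.le hst hI1 r le_rfl
    (by rw [hP, h.height_base])
  set Q : ℕ → ℝ := fun i => ((natExt l β)^[i] (natExt l β (t, v))).1 with hQ
  have hrun : ∀ i < r, Q i < 0 ∧ Q (i + 1) = -1 / Q i - l := by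
    intro i hi
    obtain ⟨q1, q2⟩ := r2 i hi
    refine ⟨q1, ?_⟩
    simp only [hQ]
    rw [Function.iterate_succ_apply', natExt, T_of_neg hl0 q1, q2]
    simp
  have hQr : Q r = tau l β k := by simp only [hQ]; rw [hP]
  have inj : ∀ a b : ℝ, 1 / a = 1 / b → a = b := fun a b hab => by simpa using hab
  have e1 : height l 1 = 1 / (l + 1) := by simp [height]
  rw [e1] at r1
  -- Now dλ + εv = λ + 1, with two solutions: ε = -1, d = 2, v = λ - 1, and ε = 1, d = 1, v = 1. The
  -- second starts right of r₁, stays right of the r's along the run, and so cannot end at τ_k,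
  -- which is left of r_{p-1}.
  rcases lt_trichotomy t 0 with ht | rfl | ht
  · have hd := one_le_digit_of_neg hl0 hl2 h0 ht hI.left
    rw [natExt_of_neg ht] at r1
    have r1 := inj _ _ r1
    have hd2 : digit l β t = 2 := by
      have : digit l β t = 1 ∨ digit l β t = 2 ∨ 3 ≤ digit l β t := by omega
      rcases this with hd | hd | hd
      · rw [hd] at r1; push_cast at r1; linarith
      · exact hd
      · have : (3 : ℝ) ≤ digit l β t := by exact_mod_cast hd
        nlinarith
    rw [hd2] at r1
    push_cast at r1
    have hQ0 : Q 0 = (-1 / t - l) - l := by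
      simp only [hQ, Function.iterate_zero, id]
      rw [natExt, T_of_neg hl0 ht, hd2]; push_cast; ring
    obtain ⟨t1, t2⟩ := h.tau_facts h0 h1 k
    have n2 : 0 < l + ycoord l β k := by
      have : 0 < β * l := by nlinarith
      linarith [le_ycoord hl hl2 h0 h1 k]
    have rel := h.block_rel hQ0 (fun i hi => ⟨(hrun i hi).1.ne, (hrun i hi).2⟩) n2.ne'
      (by rw [hQr, tau])
    have rel2 := ycoord_step hl hl2 h0 h1 k
    have y0 := le_ycoord hl hl2 h0 h1 k
    have hy : -1 / t - l = ycoord l β (k + 1) := by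
      have : 0 < β * l := by nlinarith
      have : 0 < 2 + l * ycoord l β k := by
        have := mul_nonneg hl0.le (this.le.trans y0); linarith
      have e : (2 + l * ycoord l β k) * (-1 / t - l)
        = (2 + l * ycoord l β k) * ycoord l β (k + 1) := by linear_combination rel2 - rel
      exact mul_left_cancel₀ this.ne' e
    have ht' : t = tau l β (k + 1) := by
      rw [tau, ← hy, add_sub_cancel, div_div_eq_mul_div]; simp
    have : v = l - 1 := by linarith
    rw [ht', this]
  · rw [natExt_zero (by linarith) (by nlinarith)] at r1
    have : 0 < 1 / (l + 1) := one_div_pos.mpr (by linarith)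
    simp only at r1
    linarith
  · exfalso
    have hd := one_le_digit_of_pos hl0 h1.le ht hI.right.le
    rw [natExt_of_pos ht] at r1
    have r1 := inj _ _ r1
    have hd1 : digit l β t = 1 := by
      by_contra hne
      have : (2 : ℝ) ≤ digit l β t := by exact_mod_cast (by omega : (2 : ℤ) ≤ digit l β t)
      nlinarith
    have hQ0 : Q 0 = 1 / t - l := by
      simp only [hQ, Function.iterate_zero, id]
      rw [natExt, T_of_pos hl0 ht, hd1]; push_cast; ring
    have f0 : 0 < form S (β * l) 0 (Q 0) := by
      rw [h.form_zero, hQ0]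
      have : 1 < β * l * (1 / t) := by
        rw [mul_one_div, lt_div_iff₀ ht]; linarith [hI.right]
      apply mul_pos h.one; linarith
    have := h.form_iterate hrun f0
    rw [hQr] at this
    linarith [h.form_tau_neg h0 h1 k]

theorem back_iterate (h : SineSeq r l S) {β : ℝ} (h0 : 1 / 2 ≤ β) (h1 : β * l < 1) (k : ℕ)
    {P : ℝ × ℝ} (hI : Inv r l β S False True P.1 P.2)
    (hP : (natExt l β)^[k * (r + 1)] P = (tau l β 0, l - 1)) : P = (tau l β k, l - 1) := by
  induction k generalizing P with
  | zero => simpa using hP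
  | succ k ih =>
    rw [add_mul, one_mul, Function.iterate_add_apply] at hP
    exact h.back_block h0 h1 k hI (ih (h.Inv_iterate h0 h1.le False.elim hI (r + 1)) hP)

end SineSeq

end AlphaRosen

/-! ### Endpoint orbits, and the comparison with the domain -/

namespace AlphaRosen

variable {r : ℕ} {l β : ℝ} {S : ℕ → ℝ}

theorem neg_inv_le_neg_inv {a b : ℝ} (hab : a ≤ b) (hb : b < 0) : -1 / a ≤ -1 / b := by
  rw [neg_div, neg_div, neg_le_neg_iff]
  exact one_div_le_one_div_of_neg_of_le hb hab

theorem le_neg_inv_sub (hl : 0 < l) (hl2 : l < 2) {t : ℝ} (ht : t < 0) : t ≤ -1 / t - l := by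
  rw [le_sub_iff_add_le, le_div_iff_of_neg ht]
  nlinarith [sq_nonneg (t + l / 2)]

namespace SineSeq

theorem slope_left_pos (h : SineSeq r l S) (h1 : β * l < 1) (m : ℕ) (hm : m ≤ r) :
    0 < slope S ((1 - β) * l) m := h.coeff_pos' (by linarith) m hm

theorem slope_right_pos (h : SineSeq r l S) (h0 : 1 / 2 ≤ β) (m : ℕ) (hm : m ≤ r) :
    0 < slope S (β * l) m := h.coeff_pos (by nlinarith [h.one_lt]) m hm

theorem lpt_facts (h : SineSeq r l S) (hr : 1 ≤ r) (h0 : 1 / 2 ≤ β) (h1 : β * l < 1) :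
    (∀ n ≤ r, lpt l β n < 0 ∧ lpt l β (n + 1) = -1 / lpt l β n - l) ∧
    (∀ m ≤ r, lpt l β (m + 1) = -slope S ((1 - β) * l) (m + 1) / slope S ((1 - β) * l) m) ∧
    lpt l β (r + 1) < β * l ∧ ∀ n, (β - 1) * l ≤ lpt l β n := by
  have hl := h.one_lt
  have hl2 := h.lt_two
  have hl0 : 0 < l := by linarith
  have hβ : β < 1 := by nlinarith
  have hpos := h.slope_left_pos h1
  have hc : 0 < (1 - β) * l := by nlinarith
  have hlast : -slope S ((1 - β) * l) (r + 1) < β * l * slope S ((1 - β) * l) r := by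
    rw [h.slope_top, h.slope_last]
    have h2 : 0 < β * l := by nlinarith
    have : 0 < 1 - β ^ 2 * l ^ 2 := by nlinarith
    nlinarith
  have ht0 : (β - 1) * l < 0 := by linarith
  have hz0 : -1 / ((β - 1) * l) = 1 / ((1 - β) * l) := by
    rw [← neg_div_neg_eq]; congr 1 <;> ring
  have hcl : 1 / ((1 - β) * l) < l := by
    have := hpos 1 hr
    rw [h.slope_one] at this
    have := pos_of_mul_pos_left this h.one.le
    rw [div_lt_iff₀ hc]; linarith
  have hd0 : digit l β ((β - 1) * l) = 1 :=
    digit_eq_one hl0 hl2 h0 ht0 le_rfl (by rw [hz0]; nlinarith)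
  have hT0 : T l β ((β - 1) * l) = 1 / ((1 - β) * l) - l := by
    rw [T_of_neg hl0 ht0, hd0, hz0]; simp
  have hT := T_mem (α := β) hl0 (by linarith) hβ.le ((β - 1) * l)
  have run := h.iterate_run h0 h1.le hc.ne' hpos hlast hT0 hT.1
  have hsucc : ∀ m, lpt l β (m + 1) = (T l β)^[m] (T l β ((β - 1) * l)) := fun m => by
    rw [lpt, Function.iterate_succ_apply]
  refine ⟨?_, ?_, ?_, ?_⟩
  · intro n hn
    cases n with
    | zero =>
      have : lpt l β 0 = (β - 1) * l := rfl
      rw [this, hsucc, hz0]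
      exact ⟨ht0, hT0⟩
    | succ n =>
      obtain ⟨-, -, q⟩ := run n (by omega)
      obtain ⟨q1, q2, q3⟩ := q (by omega)
      rw [hsucc, hsucc]
      exact ⟨q1, q3⟩
  · intro m hm
    rw [hsucc]; exact (run m hm).1
  · rw [hsucc, (run r le_rfl).1, div_lt_iff₀ (hpos r le_rfl)]; exact hlast
  · intro n
    cases n with
    | zero => exact le_rfl
    | succ n =>
      rw [lpt, Function.iterate_succ_apply']
      exact (T_mem hl0 (by linarith) hβ.le _).1

theorem rpt_facts (h : SineSeq r l S) (hr : 1 ≤ r) (h0 : 1 / 2 ≤ β) (h1 : β * l < 1) :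
    (∀ n, 1 ≤ n → n ≤ r → rpt l β n < 0 ∧ rpt l β (n + 1) = -1 / rpt l β n - l) ∧
    (∀ m ≤ r, rpt l β (m + 1) = -slope S (β * l) (m + 1) / slope S (β * l) m) ∧
    rpt l β 1 = 1 / (β * l) - l := by
  have hl := h.one_lt
  have hl2 := h.lt_two
  have hl0 : 0 < l := by linarith
  have hβ : β < 1 := by nlinarith
  have hpos := h.slope_right_pos h0
  have hc : 0 < β * l := by nlinarith
  have hlast : -slope S (β * l) (r + 1) < β * l * slope S (β * l) r := by
    have := mul_pos hc (hpos r le_rfl)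
    rw [h.slope_top]
    nlinarith
  have hcl : 1 / (β * l) < l := by
    have := hpos 1 hr
    rw [h.slope_one] at this
    have := pos_of_mul_pos_left this h.one.le
    rw [div_lt_iff₀ hc]; linarith
  have hd0 : digit l β (β * l) = 1 := by
    apply le_antisymm _ (one_le_digit_of_pos hl0 h1.le hc le_rfl)
    rw [← Int.lt_add_one_iff, digit_of_pos hl0 hc, Int.floor_lt]
    have : 1 / (β * l) / l < 1 := by rwa [div_lt_one hl0]
    push_cast; linarith
  have hT0 : T l β (β * l) = 1 / (β * l) - l := by
    rw [T_of_pos hl0 hc, hd0]; simp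
  have hT := T_mem (α := β) hl0 (by linarith) hβ.le (β * l)
  have run := h.iterate_run h0 h1.le hc.ne' hpos hlast hT0 hT.1
  have hsucc : ∀ m, rpt l β (m + 1) = (T l β)^[m] (T l β (β * l)) := fun m => by
    rw [rpt, Function.iterate_succ_apply]
  refine ⟨?_, ?_, ?_⟩
  · intro n hn1 hn
    obtain ⟨n, rfl⟩ : ∃ m, n = m + 1 := ⟨n - 1, by omega⟩
    obtain ⟨-, -, q⟩ := run n (by omega)
    obtain ⟨q1, q2, q3⟩ := q (by omega)
    rw [hsucc, hsucc]
    exact ⟨q1, q3⟩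
  · intro m hm
    rw [hsucc]; exact (run m hm).1
  · rw [hsucc]; exact hT0

/-- On negative numbers t ↦ -1/t - λ is increasing and, since λ < 2, lies above the identity. Hence
the order l₀ ≤ r₁ ≤ l₁ propagates along both orbits. -/
theorem endpoints (h : SineSeq r l S) (hr : 1 ≤ r) (h0 : 1 / 2 ≤ β) (h1 : β * l < 1) :
    (∀ m n, m ≤ n → n ≤ r + 1 → lpt l β m ≤ lpt l β n) ∧
    (∀ m n, 1 ≤ m → m ≤ n → n ≤ r + 1 → rpt l β m ≤ rpt l β n) ∧
    (∀ n, 1 ≤ n → n ≤ r + 1 → rpt l β n ≤ lpt l β n) ∧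
    (∀ n, n ≤ r → lpt l β n ≤ rpt l β (n + 1)) ∧
    rpt l β (r + 1) ≤ 0 ∧ 0 ≤ lpt l β (r + 1) := by
  have hl := h.one_lt
  have hl2 := h.lt_two
  have hl0 : 0 < l := by linarith
  have hc : 0 < β * l := by nlinarith
  have hc' : 0 < (1 - β) * l := by nlinarith
  obtain ⟨L1, L2, L3, L4⟩ := h.lpt_facts hr h0 h1
  obtain ⟨R1, R2, R3⟩ := h.rpt_facts hr h0 h1
  refine ⟨?_, ?_, ?_, ?_, ?_, ?_⟩
  · intro m n hmn
    induction n, hmn using Nat.le_induction with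
    | base => intro _; exact le_rfl
    | succ n _ ih =>
      intro hn
      obtain ⟨a, b⟩ := L1 n (by omega)
      refine (ih (by omega)).trans ?_
      rw [b]; exact le_neg_inv_sub hl0 hl2 a
  · intro m n hm hmn
    induction n, hmn using Nat.le_induction with
    | base => intro _; exact le_rfl
    | succ n hmn' ih =>
      intro hn
      obtain ⟨a, b⟩ := R1 n (by omega) (by omega)
      refine (ih (by omega)).trans ?_
      rw [b]; exact le_neg_inv_sub hl0 hl2 a
  · intro n hn
    induction n, hn using Nat.le_induction with
    | base =>
      intro _
      have : lpt l β (0 + 1) = 1 / ((1 - β) * l) - l := by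
        rw [(L1 0 (by omega)).2, lpt, Function.iterate_zero, id, ← neg_div_neg_eq]
        congr 2 <;> ring
      rw [R3, ← zero_add 1, this]
      have := one_div_le_one_div_of_le hc' (by nlinarith : (1 - β) * l ≤ β * l)
      linarith
    | succ n hn1 ih =>
      intro hn
      obtain ⟨a, b⟩ := R1 n (by omega) (by omega)
      obtain ⟨a', b'⟩ := L1 n (by omega)
      rw [b, b']
      linarith [neg_inv_le_neg_inv (ih (by omega)) a']
  · intro n
    induction n with
    | zero =>
      intro _
      rw [zero_add, R3]
      have : lpt l β 0 = (β - 1) * l := rfl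
      rw [this]
      have : β * l ≤ 1 / (β * l) := by rw [le_div_iff₀ hc]; nlinarith
      linarith
    | succ n ih =>
      intro hn
      obtain ⟨a, b⟩ := R1 (n + 1) (by omega) (by omega)
      obtain ⟨a', b'⟩ := L1 n (by omega)
      rw [b, b']
      linarith [neg_inv_le_neg_inv (ih (by omega)) a]
  · rw [R2 r le_rfl, h.slope_top]
    apply div_nonpos_of_nonpos_of_nonneg _ (h.slope_right_pos h0 r le_rfl).le
    nlinarith
  · rw [L2 r le_rfl, h.slope_top]
    apply div_nonneg _ (h.slope_left_pos h1 r le_rfl).le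
    nlinarith

theorem form_right_neg_iff (h : SineSeq r l S) (hr : 1 ≤ r) (h0 : 1 / 2 ≤ β) (h1 : β * l < 1)
    (m : ℕ) (hm : m ≤ r) (t : ℝ) : form S (β * l) m t < 0 ↔ t < rpt l β (m + 1) := by
  rw [(h.rpt_facts hr h0 h1).2.1 m hm, lt_div_iff₀ (h.slope_right_pos h0 m hm), form_eq_slope]
  constructor <;> intro <;> linarith

theorem form_left_neg_iff (h : SineSeq r l S) (hr : 1 ≤ r) (h0 : 1 / 2 ≤ β) (h1 : β * l < 1)
    (m : ℕ) (hm : m ≤ r) (t : ℝ) : form S ((1 - β) * l) m t < 0 ↔ t < lpt l β (m + 1) := by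
  rw [(h.lpt_facts hr h0 h1).2.1 m hm, lt_div_iff₀ (h.slope_left_pos h1 m hm), form_eq_slope]
  constructor <;> intro <;> linarith

/-- Since the endpoints interlace and the heights increase, a point left of some endpoint lies in an
interval whose height is at most the one required. -/
theorem Inv_of_mem_Omega (h : SineSeq r l S) (hr : 1 ≤ r) (h0 : 1 / 2 ≤ β) (h1 : β * l < 1)
    {P : ℝ × ℝ} (hP : P ∈ Omega l β (r + 2)) : Inv r l β S False True P.1 P.2 := by
  have hl := h.one_lt
  have hc : 0 < β * l := by nlinarith
  obtain ⟨L1, L2, L3, L4⟩ := h.lpt_facts hr h0 h1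
  obtain ⟨E1, E2, E3, E4, E5, E6⟩ := h.endpoints hr h0 h1
  obtain ⟨t, v⟩ := P
  have odd_of : ∀ m ≤ r, ∀ H, (t < rpt l β (m + 1) → v ≤ H) →
      WeakLT False (form S (β * l) m t) 0 → WeakLT True v H := by
    intro m hm H hv hf
    rcases hf with hf | ⟨hf, -⟩
    · rw [h.form_right_neg_iff hr h0 h1 m hm] at hf
      rcases (hv hf).lt_or_eq with h' | h'
      · exact Or.inl h'
      · exact Or.inr ⟨trivial, h'⟩
    · exact hf.elim
  have hp : r + 2 - 1 = r + 1 := rfl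
  simp only [Omega, Set.mem_ofPred_eq, Set.mem_prod, Set.mem_Ico, Set.mem_Icc, hp] at hP
  rcases hP with ⟨n, n1, n2, ⟨t1, t2⟩, v1, v2⟩ | ⟨n, n1, n2, ⟨t1, t2⟩, v1, v2⟩ |
    ⟨⟨t1, t2⟩, v1, v2⟩
  · refine ⟨(L4 _).trans t1, ?_, v1, v2.trans (h.height_lt_one _ (by omega)).le, ?_, ?_⟩
    · have := E2 n (r + 1) n1 n2 le_rfl
      linarith
    · intro m hm
      apply odd_of m hm
      intro hf
      apply v2.trans
      apply h.height_le _ (by omega)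
      by_contra hc
      have := E3 (m + 1) (by omega) (by omega)
      have := E1 (m + 1) (n - 1) (by omega) (by omega)
      linarith
    · intro m hm hf
      rw [h.form_left_neg_iff hr h0 h1 m hm] at hf
      apply v2.trans
      apply h.height_le _ (by omega)
      by_contra hc
      have := E1 (m + 1) (n - 1) (by omega) (by omega)
      linarith
  · obtain ⟨n, rfl⟩ : ∃ m, n = m + 1 := ⟨n - 1, by omega⟩
    have E4n := E4 n (by omega)
    refine ⟨(L4 _).trans (E4n.trans t1), ?_, v1, v2.trans (h.height_lt_one _ (by omega)).le, ?_, ?_⟩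
    · have := E1 (n + 1) (r + 1) n2 le_rfl
      linarith
    · intro m hm
      apply odd_of m hm
      intro hf
      apply v2.trans
      apply h.height_le _ (by omega)
      by_contra hc
      have := E2 (m + 1) (n + 1) (by omega) (by omega) (by omega)
      linarith
    · intro m hm hf
      rw [h.form_left_neg_iff hr h0 h1 m hm] at hf
      apply v2.trans
      apply h.height_le _ (by omega)
      by_contra hc
      have := E1 (m + 1) n (by omega) (by omega)
      linarith
  · rw [show 2 * (r + 2) - 1 = 2 * r + 3 by omega, h.height_top] at v2
    refine ⟨(L4 _).trans t1, t2, v1, v2, ?_, ?_⟩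
    · intro m hm
      apply odd_of m hm
      intro hf
      have := E2 (m + 1) (r + 1) (by omega) (by omega) le_rfl
      linarith
    · intro m hm hf
      rw [h.form_left_neg_iff hr h0 h1 m hm] at hf
      have := E1 (m + 1) (r + 1) (by omega) le_rfl
      linarith

theorem tau_mem_Omega (h : SineSeq r l S) (hr : 1 ≤ r) (h0 : 1 / 2 ≤ β) (h1 : β * l < 1) (k : ℕ) :
    (tau l β k, l - 1) ∈ Omega l β (r + 2) := by
  have hl := h.one_lt
  have hl2 := h.lt_two
  have hc : 0 < β * l := by nlinarith
  obtain ⟨L1, L2, L3, L4⟩ := h.lpt_facts hr h0 h1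
  obtain ⟨L1, L1'⟩ := L1 r le_rfl
  obtain ⟨t1, t2⟩ := h.tau_facts h0 h1 k
  left
  -- The point lies on the top edge of J_{2p-3} × [0, H_{2p-3}].
  refine ⟨r + 1, by omega, le_rfl, ⟨?_, ?_⟩, ?_, ?_⟩
  · simp only [Nat.add_sub_cancel]
    by_contra hlt
    push Not at hlt
    have := neg_inv_le_neg_inv hlt.le L1
    have := le_ycoord hl hl2 h0 h1 k
    linarith
  · exact (h.form_right_neg_iff hr h0 h1 r le_rfl _).1 (h.form_tau_neg h0 h1 k)
  · simp only; linarith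
  · rw [show 2 * (r + 1) - 1 = 2 * r + 1 by omega, h.height_base]

theorem preimages_eq (h : SineSeq r l S) (hr : 1 ≤ r) (h0 : 1 / 2 ≤ β) (h1 : β * l < 1) (k : ℕ) :
    {P | P ∈ Omega l β (r + 2) ∧ (natExt l β)^[k * (r + 1)] P = (tau l β 0, l - 1)}
      = {(tau l β k, l - 1)} := by
  ext P
  simp only [Set.mem_ofPred_eq, Set.mem_singleton_iff]
  constructor
  · rintro ⟨hP, hk⟩
    exact h.back_iterate h0 h1 k (h.Inv_of_mem_Omega hr h0 h1 hP) hk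
  · rintro rfl
    exact ⟨h.tau_mem_Omega hr h0 h1 k, h.natExt_block_iterate h0 h1 k⟩

end SineSeq

theorem tau_zero (h : 0 < β * l) : tau l β 0 = -delta l β 1 := by
  rw [tau, ycoord_zero h, delta, neg_div]; congr 2; ring

end AlphaRosen

/-! ### Convergents, the Hecke group and the approximation coefficients -/

namespace AlphaRosen

variable {r : ℕ} {l α x : ℝ} {S : ℕ → ℝ} {st sv : Prop}

/-- The numerator `p_{n-1}`. -/
noncomputable def numPrev (l α x : ℝ) : ℕ → ℝ
  | 0 => 1
  | n + 1 => num l α x n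

/-- The denominator `q_{n-1}`. -/
noncomputable def denPrev (l α x : ℝ) : ℕ → ℝ
  | 0 => 0
  | n + 1 => den l α x n

/-- The orbit of `x - d₀ l` under `T_α`. -/
noncomputable def orbit (l α x : ℝ) (n : ℕ) : ℝ := (T l α)^[n] (fracPart l α x)

theorem num_succ (n : ℕ) : num l α x (n + 1) =
    digit l α (orbit l α x n) * l * num l α x n
      + Real.sign (orbit l α x n) * numPrev l α x n := by
  cases n <;> simp [num, numPrev, d, eps, orbit]

theorem den_succ (n : ℕ) : den l α x (n + 1) =
    digit l α (orbit l α x n) * l * den l α x n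
      + Real.sign (orbit l α x n) * denPrev l α x n := by
  cases n <;> simp [den, denPrev, d, eps, orbit]

theorem orbit_succ (n : ℕ) : orbit l α x (n + 1) = T l α (orbit l α x n) :=
  Function.iterate_succ_apply' _ _ _

namespace SineSeq

theorem Inv_start (h : SineSeq r l S) (x : ℝ) : Inv r l α S st sv (fracPart l α x) 0 := by
  have hl := h.one_lt
  obtain ⟨h1, h2⟩ := fracPart_mem (α := α) (by linarith : 0 < l) x
  exact h.Inv_of_lt_height_one h1 h2 le_rfl (Or.inl (one_div_pos.mpr (by linarith)))

/-- The sum `d l + ε v` is positive away from `t = 0`. -/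
theorem digit_add_pos (h : SineSeq r l S) (h0 : 1 / 2 ≤ α) (h1 : α * l ≤ 1) {t v : ℝ}
    (hI : Inv r l α S st sv t v) (ht : t ≠ 0) : 0 < digit l α t * l + Real.sign t * v := by
  have hl := h.one_lt
  have hl0 : 0 < l := by linarith
  have hv0 := hI.nonneg
  have hv1 := hI.le_one
  rcases lt_or_gt_of_ne ht with ht | ht
  · have : (1 : ℝ) ≤ digit l α t := by
      exact_mod_cast one_le_digit_of_neg hl0 h.lt_two h0 ht hI.left
    rw [Real.sign_of_neg ht]; nlinarith
  · have : (1 : ℝ) ≤ digit l α t := by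
      exact_mod_cast one_le_digit_of_pos hl0 h1 ht hI.right.le
    rw [Real.sign_of_pos ht]; nlinarith

theorem natExt_orbit (h : SineSeq r l S) (h0 : 1 / 2 ≤ α) (h1 : α * l ≤ 1) (n : ℕ)
    (hnz : ∀ i < n, orbit l α x i ≠ 0) : 0 < den l α x n ∧
      (natExt l α)^[n] (fracPart l α x, 0) = (orbit l α x n, denPrev l α x n / den l α x n) := by
  induction n with
  | zero => simp [den, denPrev, orbit]
  | succ n ih =>
    obtain ⟨i1, i2⟩ := ih fun i hi => hnz i (by omega)
    have hI := h.Inv_iterate (st := False) (sv := True) h0 h1 False.elim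
      (P := (fracPart l α x, 0)) (h.Inv_start x) n
    rw [i2] at hI
    have hp := h.digit_add_pos h0 h1 hI (hnz n (by omega))
    have e : den l α x (n + 1) = den l α x n * (digit l α (orbit l α x n) * l +
        Real.sign (orbit l α x n) * (denPrev l α x n / den l α x n)) := by
      rw [den_succ]; field_simp
    have hpos : 0 < den l α x (n + 1) := by rw [e]; exact mul_pos i1 hp
    refine ⟨hpos, ?_⟩
    rw [Function.iterate_succ_apply', i2, natExt, orbit_succ, e, denPrev]
    congr 1
    simp only at hp ⊢
    field_simp

end SineSeq

/-- This is x = (p_n + t_n p_{n-1})/(q_n + t_n q_{n-1}) without the division. -/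
theorem convergent_rel (hl : 0 < l) (n : ℕ) (hnz : ∀ i < n, orbit l α x i ≠ 0) :
    x * (den l α x n + orbit l α x n * denPrev l α x n)
      = num l α x n + orbit l α x n * numPrev l α x n := by
  induction n with
  | zero => simp [den, num, denPrev, numPrev, orbit, fracPart]
  | succ n ih =>
    have ih := ih fun i hi => hnz i (by omega)
    have ht := hnz n (by omega)
    rw [num_succ, den_succ, orbit_succ, T_eq hl ht, denPrev, numPrev]
    have hs : Real.sign (orbit l α x n) ≠ 0 := by
      rcases Real.sign_apply_eq_of_ne_zero _ ht with h | h <;> rw [h] <;> norm_num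
    field_simp
    linear_combination Real.sign (orbit l α x n) * ih

/-- The matrix of `x ↦ x + k l`. -/
noncomputable def shiftMat (l : ℝ) (k : ℤ) : Matrix.SpecialLinearGroup (Fin 2) ℝ :=
  ⟨!![1, k * l; 0, 1], by simp [Matrix.det_fin_two]⟩

theorem shiftMat_mem (l : ℝ) (k : ℤ) : shiftMat l k ∈ Hecke l := by
  have hS : matS l ∈ Hecke l := Subgroup.subset_closure (by simp)
  have hadd : ∀ a b : ℤ, shiftMat l (a + b) = shiftMat l a * shiftMat l b := by
    intro a b
    apply Subtype.ext
    change (shiftMat l (a + b)).1 = (shiftMat l a).1 * (shiftMat l b).1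
    simp only [shiftMat, Matrix.mul_fin_two]
    push_cast
    ext i j
    fin_cases i <;> fin_cases j <;> simp
    ring
  have hone : shiftMat l 1 = matS l := by
    ext i j
    fin_cases i <;> fin_cases j <;> simp [shiftMat, matS]
  have hzero : shiftMat l 0 = 1 := by
    ext i j
    fin_cases i <;> fin_cases j <;> simp [shiftMat]
  have hneg : shiftMat l (-1) = (matS l)⁻¹ := by
    rw [eq_inv_iff_mul_eq_one, ← hone, ← hadd, neg_add_cancel, hzero]
  induction k with
  | zero => rw [hzero]; exact one_mem _
  | succ k ih => rw [hadd, hone]; exact mul_mem ih hS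
  | pred k ih =>
    rw [sub_eq_add_neg, hadd, hneg]
    exact mul_mem ih (inv_mem hS)

theorem exists_mul_shift {M : Matrix.SpecialLinearGroup (Fin 2) ℝ} (hM : M ∈ Hecke l) (k : ℤ) :
    ∃ N ∈ Hecke l, N.1 0 0 = M.1 0 0 * (k * l) + M.1 0 1 ∧ N.1 0 1 = -M.1 0 0 ∧
      N.1 1 0 = M.1 1 0 * (k * l) + M.1 1 1 ∧ N.1 1 1 = -M.1 1 0 := by
  have hT : matT ∈ Hecke l := Subgroup.subset_closure (by simp)
  refine ⟨M * shiftMat l k * matT, mul_mem (mul_mem hM (shiftMat_mem l k)) hT, ?_⟩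
  have e : (M * shiftMat l k * matT).1 = M.1 * (shiftMat l k).1 * matT.1 := rfl
  rw [e]
  simp [shiftMat, matT, Matrix.mul_apply, Fin.sum_univ_two]

/-- The convergent matrix has determinant ±1, so signs on its columns are needed to land in the
group. This yields both the determinant and the fact that a vanishing t_n makes x = p_n/q_n a
G_q-rational. -/
theorem exists_hecke (n : ℕ) (hnz : ∀ i < n, orbit l α x i ≠ 0) :
    ∃ M ∈ Hecke l, ∃ s s' : ℤ, s ^ 2 = 1 ∧ s' ^ 2 = 1 ∧
      M.1 0 0 = s * num l α x n ∧ M.1 0 1 = s' * numPrev l α x n ∧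
      M.1 1 0 = s * den l α x n ∧ M.1 1 1 = s' * denPrev l α x n := by
  induction n with
  | zero =>
    obtain ⟨N, hN, h1, h2, h3, h4⟩ := exists_mul_shift (one_mem (Hecke l)) (intPart l α x)
    refine ⟨N, hN, 1, -1, by norm_num, by norm_num, ?_⟩
    rw [h1, h2, h3, h4]
    simp [num, den, numPrev, denPrev]
  | succ n ih =>
    obtain ⟨M, hM, s, s', hs, hs', m1, m2, m3, m4⟩ := ih fun i hi => hnz i (by omega)
    obtain ⟨e, he, hsgn⟩ : ∃ e : ℤ, e ^ 2 = 1 ∧ Real.sign (orbit l α x n) = e := by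
      rcases Real.sign_apply_eq_of_ne_zero _ (hnz n (by omega)) with h | h
      · exact ⟨-1, by norm_num, by simp [h]⟩
      · exact ⟨1, by norm_num, by simp [h]⟩
    obtain ⟨N, hN, h1, h2, h3, h4⟩ :=
      exists_mul_shift hM (s * s' * e * digit l α (orbit l α x n))
    refine ⟨N, hN, s' * e, -s, by rw [mul_pow, hs', he, mul_one], by simpa using hs, ?_⟩
    have hsR : (s : ℝ) ^ 2 = 1 := by exact_mod_cast hs
    have heR : (e : ℝ) ^ 2 = 1 := by exact_mod_cast he
    rw [h1, h2, h3, h4, m1, m2, m3, m4, num_succ, den_succ, hsgn, numPrev, denPrev]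
    push_cast
    refine ⟨?_, by ring, ?_, by ring⟩
    · linear_combination s' * e * digit l α (orbit l α x n) * l * num l α x n * hsR
        - s' * numPrev l α x n * heR
    · linear_combination s' * e * digit l α (orbit l α x n) * l * den l α x n * hsR
        - s' * denPrev l α x n * heR

theorem det_sq (n : ℕ) (hnz : ∀ i < n, orbit l α x i ≠ 0) :
    |numPrev l α x n * den l α x n - num l α x n * denPrev l α x n| = 1 := by
  obtain ⟨M, -, s, s', hs, hs', m1, m2, m3, m4⟩ := exists_hecke n hnz
  have hdet := M.2
  rw [Matrix.det_fin_two, m1, m2, m3, m4] at hdet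
  have hsR : (s : ℝ) ^ 2 = 1 := by exact_mod_cast hs
  have hsR' : (s' : ℝ) ^ 2 = 1 := by exact_mod_cast hs'
  rw [← abs_one, ← sq_eq_sq_iff_abs_eq_abs, one_pow]
  have e : (s : ℝ) ^ 2 * (s' : ℝ) ^ 2 * (numPrev l α x n * den l α x n
      - num l α x n * denPrev l α x n) ^ 2 = 1 := by
    have : (s : ℝ) * s' * (num l α x n * denPrev l α x n - numPrev l α x n * den l α x n) = 1 := by
      linear_combination hdet
    rw [← one_pow 2, ← this]; ring
  rw [hsR, hsR'] at e
  linarith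

namespace SineSeq

theorem orbit_ne_zero (h : SineSeq r l S) (h0 : 1 / 2 ≤ α) (h1 : α * l ≤ 1)
    (hx : ¬ IsGRational l x) (n : ℕ) : orbit l α x n ≠ 0 := by
  induction n using Nat.strong_induction_on with
  | _ n ih =>
    intro hz
    apply hx
    obtain ⟨M, hM, s, s', hs, -, m1, -, m3, -⟩ := exists_hecke n ih
    have hden := (h.natExt_orbit h0 h1 n ih).1
    have hs0 : (s : ℝ) ≠ 0 := by
      intro h; have : s = 0 := by exact_mod_cast h
      rw [this] at hs; norm_num at hs
    refine ⟨M, hM, by rw [m3]; exact mul_ne_zero hs0 hden.ne', ?_⟩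
    have := convergent_rel (x := x) (α := α) (by linarith [h.one_lt] : 0 < l) n ih
    rw [hz] at this
    rw [m1, m3, mul_div_mul_left _ _ hs0, eq_div_iff hden.ne']
    linarith

theorem one_add_mul_pos (h : SineSeq r l S) (h0 : 1 / 2 ≤ α) {t v : ℝ}
    (hI : Inv r l α S st sv t v) : 0 < 1 + t * v := by
  have := hI.left
  have := hI.nonneg
  have := hI.le_one
  have : -1 < t := by nlinarith [h.one_lt, h.lt_two]
  rcases le_total 0 t with ht | ht
  · positivity
  · nlinarith

/-- `Θ_n` and `Θ_{n-1}` in terms of `(t_n, v_n)`. -/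
theorem Theta_eq (h : SineSeq r l S) (h0 : 1 / 2 ≤ α) (h1 : α * l ≤ 1)
    (hx : ¬ IsGRational l x) (n : ℕ) {t v : ℝ}
    (hP : (natExt l α)^[n + 1] (fracPart l α x, 0) = (t, v)) :
    t ≠ 0 ∧ 0 < v ∧ t = orbit l α x (n + 1) ∧ Theta l α x (n + 1) = |t| / (1 + t * v) ∧
      Theta l α x n = v / (1 + t * v) := by
  have hnz := h.orbit_ne_zero h0 h1 hx
  obtain ⟨q0, -⟩ := h.natExt_orbit (x := x) h0 h1 n fun i _ => hnz i
  obtain ⟨q1, e⟩ := h.natExt_orbit (x := x) h0 h1 (n + 1) fun i _ => hnz i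
  have hI := h.Inv_iterate (st := False) (sv := True) h0 h1 False.elim
      (P := (fracPart l α x, 0)) (h.Inv_start x) (n + 1)
  rw [hP] at hI
  have hpos := h.one_add_mul_pos h0 hI
  rw [hP, Prod.mk.injEq] at e
  obtain ⟨rfl, rfl⟩ := e
  have rel := convergent_rel (x := x) (α := α) (by linarith [h.one_lt] : 0 < l) (n + 1)
    fun i _ => hnz i
  have hdet := det_sq (x := x) (α := α) (l := l) (n + 1) fun i _ => hnz i
  have hnzt := hnz (n + 1)
  clear hnz
  simp only [denPrev, numPrev] at *
  generalize orbit l α x (n + 1) = t at *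
  simp only [Theta]
  generalize den l α x (n + 1) = Q at *
  generalize den l α x n = Q' at *
  generalize num l α x (n + 1) = P at *
  generalize num l α x n = P' at *
  have hE : Q + t * Q' = Q * (1 + t * (Q' / Q)) := by field_simp
  have hEp : 0 < Q + t * Q' := by rw [hE]; exact mul_pos q1 hpos
  have e1 : x - P / Q = t * (P' * Q - P * Q') / (Q * (Q + t * Q')) := by
    field_simp; linear_combination Q * rel
  have e2 : x - P' / Q' = -(P' * Q - P * Q') / (Q' * (Q + t * Q')) := by
    have e3 : (x - P' / Q') * Q' = x * Q' - P' := by field_simp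
    rw [eq_div_iff (mul_pos q0 hEp).ne']
    linear_combination (Q + t * Q') * e3 + Q' * rel
  refine ⟨hnzt, div_pos q0 q1, trivial, ?_, ?_⟩
  · rw [e1, abs_div, abs_mul, hdet, abs_of_pos (mul_pos q1 hEp), hE]
    field_simp
  · rw [e2, abs_div, abs_neg, hdet, abs_of_pos (mul_pos q0 hEp), hE]
    field_simp

end SineSeq

end AlphaRosen

/-! ### Stretches with large approximation coefficients -/

namespace AlphaRosen

variable {r : ℕ} {l α : ℝ} {S : ℕ → ℝ} {st sv : Prop}

theorem cross_rel {m : ℕ} {y : ℕ → ℝ}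
    (hy : ∀ j < m, y (j + 1) * (2 - l * y j) = 2 * y j - l) :
    (2 + l) ^ m * (1 + y m) * (1 - y 0) = (2 - l) ^ m * (1 + y 0) * (1 - y m) := by
  induction m with
  | zero => ring
  | succ m ih =>
    have ih := ih fun j hj => hy j (by omega)
    have e := hy m (by omega)
    have e' : (2 + l) * (1 + y (m + 1)) * (1 - y m) = (2 - l) * (1 + y m) * (1 - y (m + 1)) := by
      linear_combination 2 * e
    -- The factors 1 - y and 1 + y cannot both vanish; the induction cancels whichever is nonzero.
    by_cases h : 1 - y m = 0
    · have : 1 + y m ≠ 0 := by intro h'; linarith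
      apply mul_left_cancel₀ this
      linear_combination (2 + l) * (1 + y (m + 1)) * ih + (2 - l) ^ m * (1 + y 0) * e'
    · apply mul_left_cancel₀ h
      linear_combination (2 + l) ^ m * (1 - y 0) * e' + (2 - l) * (1 - y (m + 1)) * ih

/-- A stretch `n, …, e` of an orbit of the natural extension on which all approximation
coefficients are at least `1 / κ`. -/
structure Stretch (r : ℕ) (l α : ℝ) (S : ℕ → ℝ) (st : Prop) (n e : ℕ) (κ : ℝ)
    (t v : ℕ → ℝ) : Prop where
  inv : ∀ i, Inv r l α S st False (t i) (v i)
  step : ∀ i, (t (i + 1), v (i + 1)) = natExt l α (t i, v i)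
  neg : ∀ i, n ≤ i → i ≤ e → t i < 0
  bound : ∀ i, n ≤ i → i ≤ e → -1 / t i - v i ≤ κ
  pos : ∀ i, n ≤ i → i ≤ e → 0 < v i
  lt_two : κ < 2

namespace Stretch

variable {n e : ℕ} {κ : ℝ} {t v : ℕ → ℝ}

theorem t_succ (w : Stretch r l α S st n e κ t v) (hl : 0 < l) {i : ℕ} (h1 : n ≤ i) (h2 : i ≤ e) :
    t (i + 1) = -1 / t i - l * (digit l α (t i) : ℤ) := by
  have := congrArg Prod.fst (w.step i)
  simp only [natExt] at this
  rw [this, T_of_neg hl (w.neg i h1 h2)]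

theorem v_succ (w : Stretch r l α S st n e κ t v) {i : ℕ} (h1 : n ≤ i) (h2 : i ≤ e) :
    v (i + 1) = 1 / (digit l α (t i) * l - v i) := by
  have := congrArg Prod.snd (w.step i)
  rwa [natExt_of_neg (w.neg i h1 h2)] at this

theorem v_le (w : Stretch r l α S st n e κ t v) (h : SineSeq r l S) (h0 : 1 / 2 ≤ α)
    (h1 : α * l ≤ 1) {i : ℕ} (hn : n ≤ i) (he : i ≤ e) : v i ≤ l / 2 := by
  rw [← h.height_pre]
  exact (w.inv i).even r le_rfl (h.form_left_last_neg h0 h1 (w.neg i hn he))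

theorem digit_cases (w : Stretch r l α S st n e κ t v) (h : SineSeq r l S) (h0 : 1 / 2 ≤ α)
    (h1 : α * l ≤ 1) {i : ℕ} (hn : n ≤ i) (he : i ≤ e) :
    digit l α (t i) = 1 ∨ digit l α (t i) = 2 := by
  have hl := h.one_lt
  have hl0 : 0 < l := by linarith
  have ht := w.neg i hn he
  have hd := one_le_digit_of_neg hl0 h.lt_two h0 ht (w.inv i).left
  obtain ⟨hz, -⟩ := (digit_neg_iff hl0 ht (digit l α (t i))).1 rfl
  by_contra hc
  have : (3 : ℝ) ≤ digit l α (t i) := by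
    exact_mod_cast (by omega : (3 : ℤ) ≤ digit l α (t i))
  have := w.bound i hn he
  have := w.v_le h h0 h1 hn he
  have := w.lt_two
  nlinarith

/-- Starting at or beyond l₀, a run of p - 1 digits -1 would reach l_{p-1} or beyond, which is not
negative. -/
theorem not_ones (w : Stretch r l α S st n e κ t v) (h : SineSeq r l S) (h0 : 1 / 2 ≤ α)
    (h1 : α * l ≤ 1) {i : ℕ} (hn : n ≤ i) (he : i + r + 1 ≤ e) :
    ∃ j ≤ r, digit l α (t (i + j)) = 2 := by
  have hl := h.one_lt
  have hl0 : 0 < l := by linarith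
  by_contra hc
  push Not at hc
  have hone : ∀ j ≤ r, t (i + j + 1) = -1 / t (i + j) - l := by
    intro j hj
    rw [w.t_succ hl0 (by omega) (by omega)]
    rcases w.digit_cases h h0 h1 (i := i + j) (by omega) (by omega) with h' | h'
    · rw [h']; simp
    · exact absurd h' (hc j hj)
  have key : ∀ j ≤ r, 0 ≤ form S ((1 - α) * l) j (t (i + j + 1)) := by
    intro j
    induction j with
    | zero =>
      intro _
      rw [hone 0 (by omega), h.form_zero]
      have ht := w.neg (i + 0) (by omega) (by omega)
      have : 1 ≤ (1 - α) * l * (-1 / t (i + 0)) := by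
        rw [mul_div_assoc', le_div_iff_of_neg ht]
        linarith [(w.inv (i + 0)).left]
      apply mul_nonneg h.one.le
      linarith
    | succ j ih =>
      intro hj
      have ht := w.neg (i + (j + 1)) (by omega) (by omega)
      rw [hone (j + 1) hj, h.form_succ _ _ ht.ne]
      exact mul_nonneg (div_nonneg_of_nonpos (by norm_num) ht.le) (ih (by omega))
  have := h.form_left_last_neg h0 h1 (w.neg (i + r + 1) (by omega) (by omega))
  linarith [key r le_rfl]

theorem digit_eq_one_of_le (w : Stretch r l α S st n e κ t v) (h : SineSeq r l S)
    (h0 : 1 / 2 ≤ α) (h1 : α * l ≤ 1) {i j : ℕ} (hn : n ≤ i) (he : i ≤ e) (hj : j ≤ r)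
    (hv : v i ≤ height l (2 * j)) : digit l α (t i) = 1 := by
  have hl := h.one_lt
  have hl0 : 0 < l := by linarith
  by_contra hne
  have h3 := (w.digit_cases h h0 h1 hn he).resolve_left hne
  obtain ⟨hz, -⟩ := (digit_neg_iff hl0 (w.neg i hn he) _).1 h3
  have hb := w.bound i hn he
  have hh := h.height_le (m := 2 * j) (n := 2 * r) (by omega) (by omega)
  rw [h.height_even r (by omega), h.pre, h.prepre] at hh
  have e3 : (l ^ 2 / 2 - 1) / (l / 2) = l - 2 / l := by field_simp
  -- Digit 2 gives -1/t ≥ 3λ/2, while v ≤ H_{2r} = λ - 2/λ; the difference would be at least 2,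
  -- against κ < 2.
  have e4 : 2 ≤ l / 2 + 2 / l := by
    have : l / 2 + 2 / l = 2 + (l - 2) ^ 2 / (2 * l) := by field_simp; ring
    rw [this]; have : 0 ≤ (l - 2) ^ 2 / (2 * l) := by positivity
    linarith
  have := w.lt_two
  push_cast at hz
  nlinarith

/-- After a digit 2 one has v ≤ 1/λ = H₂; as long as the even-height bound persists the digit is 1,
and each such digit raises the bound from H_{2j} to H_{2j+2}. -/
theorem after_two (w : Stretch r l α S st n e κ t v) (h : SineSeq r l S) (h0 : 1 / 2 ≤ α)
    (h1 : α * l ≤ 1) {b : ℕ} (hn : n ≤ b) (h2 : digit l α (t b) = 2) (j : ℕ) (hj : j + 1 ≤ r)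
    (he : b + (j + 1) ≤ e) : digit l α (t (b + (j + 1))) = 1 := by
  have hl := h.one_lt
  have hl0 : 0 < l := by linarith
  suffices hv : v (b + (j + 1)) ≤ height l (2 * (j + 1)) from
    w.digit_eq_one_of_le h h0 h1 (by omega) he hj hv
  induction j with
  | zero =>
    rw [zero_add, w.v_succ hn (by omega), h2]
    have := (w.inv b).le_one
    have e2 : height l (2 * 1) = 1 / l := by simp [height]
    rw [e2]
    push_cast
    exact one_div_le_one_div_of_le hl0 (by linarith)
  | succ j ih =>
    have ih' := ih (by omega) (by omega)
    have hd := w.digit_eq_one_of_le h h0 h1 (i := b + (j + 1)) (by omega) (by omega)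
      (by omega) ih'
    rw [show b + (j + 1 + 1) = b + (j + 1) + 1 by ring, w.v_succ (by omega) (by omega), hd,
      show 2 * (j + 1 + 1) = 2 * (j + 1) + 2 by ring, height]
    have := h.height_lt_one (2 * (j + 1)) (by omega)
    push_cast
    exact one_div_le_one_div_of_le (by linarith) (by linarith)

theorem next_two (w : Stretch r l α S st n e κ t v) (h : SineSeq r l S) (h0 : 1 / 2 ≤ α)
    (h1 : α * l ≤ 1) {b : ℕ} (hn : n ≤ b) (h2 : digit l α (t b) = 2) (he : b + r + 2 ≤ e) :
    digit l α (t (b + (r + 1))) = 2 := by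
  obtain ⟨j, hj, hd⟩ := w.not_ones h h0 h1 (i := b + 1) (by omega) (by omega)
  rcases hj.lt_or_eq with hj | rfl
  · have := w.after_two h h0 h1 hn h2 j (by omega) (by omega)
    rw [show b + (j + 1) = b + 1 + j by ring, hd] at this
    norm_num at this
  · rwa [show b + (j + 1) = b + 1 + j by ring]

theorem t_block (w : Stretch r l α S st n e κ t v) (h : SineSeq r l S) (h0 : 1 / 2 ≤ α)
    (h1 : α * l ≤ 1) {b : ℕ} (hn : n ≤ b) (h2 : digit l α (t b) = 2) (he : b + (r + 1) ≤ e) :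
    (-1 / t (b + (r + 1)) - l) * (2 - l * (-1 / t b - l)) = 2 * (-1 / t b - l) - l := by
  have hl0 : 0 < l := by linarith [h.one_lt]
  have ht := w.neg (b + (r + 1)) (by omega) he
  refine h.block_rel (t := fun i => t (b + (i + 1))) ?_ ?_
    (div_ne_zero (by norm_num) ht.ne) ?_
  · simp only [zero_add]
    rw [w.t_succ hl0 hn (by omega), h2]; push_cast; ring
  · intro i hi
    refine ⟨(w.neg _ (by omega) (by omega)).ne, ?_⟩
    rw [show b + (i + 1 + 1) = b + (i + 1) + 1 by ring, w.t_succ hl0 (by omega) (by omega),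
      w.after_two h h0 h1 hn h2 i (by omega) (by omega)]
    simp
  · rw [div_div_eq_mul_div]; simp

/-- Under digit -1 the quantity -1/v evolves exactly as t does, so v - λ satisfies the same block
relation. -/
theorem v_block (w : Stretch r l α S st n e κ t v) (h : SineSeq r l S) (h0 : 1 / 2 ≤ α)
    (h1 : α * l ≤ 1) {b : ℕ} (hn : n ≤ b) (h2 : digit l α (t b) = 2) (he : b + (r + 1) ≤ e) :
    (v (b + (r + 1)) - l) * (2 - l * (v b - l)) = 2 * (v b - l) - l := by
  have hl0 : 0 < l := by linarith [h.one_lt]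
  refine h.block_rel (t := fun i => -1 / v (b + (i + 1))) ?_ ?_
    (w.pos (b + (r + 1)) (by omega) he).ne' rfl
  · simp only [zero_add]
    rw [w.v_succ hn (by omega), h2, div_div_eq_mul_div]; push_cast; ring
  · intro i hi
    refine ⟨div_ne_zero (by norm_num) (w.pos _ (by omega) (by omega)).ne', ?_⟩
    rw [show b + (i + 1 + 1) = b + (i + 1) + 1 by ring, w.v_succ (by omega) (by omega),
      w.after_two h h0 h1 hn h2 i (by omega) (by omega), div_div_eq_mul_div,
      div_div_eq_mul_div]
    simp

theorem twos (w : Stretch r l α S st n e κ t v) (h : SineSeq r l S) (h0 : 1 / 2 ≤ α)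
    (h1 : α * l ≤ 1) {a m : ℕ} (hn : n ≤ a) (h2 : digit l α (t a) = 2)
    (he : a + m * (r + 1) + 1 ≤ e) (j : ℕ) (hj : j ≤ m) :
    digit l α (t (a + j * (r + 1))) = 2 := by
  induction j with
  | zero => simpa using h2
  | succ j ih =>
    have hle : (j + 1) * (r + 1) ≤ m * (r + 1) := Nat.mul_le_mul_right _ hj
    have e1 : (j + 1) * (r + 1) = j * (r + 1) + (r + 1) := by ring
    rw [e1, ← add_assoc]
    exact w.next_two h h0 h1 (by omega) (ih (by omega)) (by omega)

/-- A stretch of `k (p - 1) + 1` points contains `k` points with digit `-2`, at distance `p - 1`;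
`y` and `η` are their coordinates `-1 / t - l` and `v - l`. -/
theorem exists_chain {k : ℕ} (w : Stretch r l α S st n (n + (k + 1) * (r + 1)) κ t v)
    (h : SineSeq r l S) (h0 : 1 / 2 ≤ α) (h1 : α * l ≤ 1) :
    ∃ y η : ℕ → ℝ, (∀ j < k, y (j + 1) * (2 - l * y j) = 2 * y j - l) ∧
      (∀ j < k, η (j + 1) * (2 - l * η j) = 2 * η j - l) ∧
      (∀ j ≤ k, α * l ≤ y j ∧ y j - η j ≤ κ ∧ η j ≤ -l / 2) ∧
      (WeakLT st (form S (α * l) r (-1 / (y 0 + l))) 0 → η 0 < -1) := by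
  have hl0 : 0 < l := by linarith [h.one_lt]
  have e1 : (k + 1) * (r + 1) = k * (r + 1) + (r + 1) := by ring
  obtain ⟨i, hi, h2⟩ := w.not_ones h h0 h1 (i := n) le_rfl (by nlinarith)
  have he : n + i + k * (r + 1) + 1 ≤ n + (k + 1) * (r + 1) := by omega
  have htwo := w.twos h h0 h1 (a := n + i) (m := k) (by omega) h2 he
  have hle : ∀ j ≤ k, n + i + j * (r + 1) ≤ n + (k + 1) * (r + 1) := by
    intro j hj
    have := Nat.mul_le_mul_right (r + 1) hj
    omega
  refine ⟨fun j => -1 / t (n + i + j * (r + 1)) - l, fun j => v (n + i + j * (r + 1)) - l,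
    ?_, ?_, ?_, ?_⟩
  · intro j hj
    have := hle (j + 1) hj
    have e2 : n + i + (j + 1) * (r + 1) = n + i + j * (r + 1) + (r + 1) := by ring
    simp only
    rw [e2] at this ⊢
    exact w.t_block h h0 h1 (by omega) (htwo j hj.le) this
  · intro j hj
    have := hle (j + 1) hj
    have e2 : n + i + (j + 1) * (r + 1) = n + i + j * (r + 1) + (r + 1) := by ring
    simp only
    rw [e2] at this ⊢
    exact w.v_block h h0 h1 (by omega) (htwo j hj.le) this
  · intro j hj
    have ht := w.neg (n + i + j * (r + 1)) (by omega) (hle j hj)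
    obtain ⟨hz, -⟩ := (digit_neg_iff hl0 ht _).1 (htwo j hj)
    have hb := w.bound (n + i + j * (r + 1)) (by omega) (hle j hj)
    have hv := w.v_le h h0 h1 (i := n + i + j * (r + 1)) (by omega) (hle j hj)
    push_cast at hz
    refine ⟨?_, ?_, ?_⟩ <;> simp only <;> linarith
  · intro hf
    have e3 : -1 / (-1 / t (n + i) - l + l) = t (n + i) := by
      rw [sub_add_cancel, div_div_eq_mul_div]; simp
    simp only [zero_mul, add_zero] at hf ⊢
    rw [e3] at hf
    have := (w.inv (n + i)).odd r le_rfl hf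
    rw [h.height_base] at this
    rcases this with h' | ⟨h', -⟩
    · linarith
    · exact h'.elim

end Stretch

/-- For α < 1/λ, points at or right of r_{p-1} have y bounded away from 1, on the far side of the
repelling fixed point. -/
theorem far_right (h : SineSeq r l S) {y : ℝ} (hy : 0 < y + l)
    (hf : 0 ≤ form S (α * l) r (-1 / (y + l))) :
    (2 + l) * (1 - α * l) ≤ (2 * α - 1) * l * (y - 1) := by
  rw [h.form_last] at hf
  have e : ((α * l) * l / 2 - l ^ 2 / 2 + 1) * (-1 / (y + l)) * (y + l)
      = -((α * l) * l / 2 - l ^ 2 / 2 + 1) := by field_simp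
  have := mul_nonneg hf hy.le
  nlinarith

theorem not_stretch_of_lt (h : SineSeq r l S) (h0 : 1 / 2 ≤ α) (h1 : α * l < 1) :
    ∃ K : ℕ, ∀ k, K ≤ k → ∀ n t v,
      ¬ Stretch r l α S False n (n + (k + 1) * (r + 1)) (2 / (1 + rho l α k)) t v := by
  have hl := h.one_lt
  have hl2 := h.lt_two
  have hq0 : 0 ≤ (2 - l) / (2 + l) := div_nonneg (by linarith) (by linarith)
  have hq1 : (2 - l) / (2 + l) < 1 := by rw [div_lt_one (by linarith)]; linarith
  -- Right of r_{p-1} one has y - 1 ≥ 1 - αλ and 1 + y ≤ 4, so (y - 1)/(y + 1) starts at no less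
  -- than this bound. It grows by (2 + λ)/(2 - λ) per block yet stays below 1.
  obtain ⟨K, hK⟩ := exists_pow_lt_of_lt_one (by linarith : 0 < (1 - α * l) / 4) hq1
  refine ⟨K, fun k hk n t v w => ?_⟩
  obtain ⟨y, η, hy, -, hb, hfirst⟩ := w.exists_chain h h0 h1.le
  have hc : 0 < α * l := by nlinarith
  have cross := cross_rel hy
  obtain ⟨b1, b2, b3⟩ := hb 0 (by omega)
  obtain ⟨d1, d2, d3⟩ := hb k le_rfl
  have hρ := rho_pos hl hl2 h0 h1 k
  have hP : 0 < (2 + l) ^ k := by positivity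
  have hM : 0 < (2 - l) ^ k := pow_pos (by linarith) k
  have hρe : (2 + l) ^ k * rho l α k * (1 + α * l) = (2 - l) ^ k * (1 - α * l) := by
    rw [rho, div_pow]; field_simp
  -- Left of r_{p-1}: η₀ < -1 puts y₀ strictly below the coordinate of τ_k, so y_k would fall below
  -- αλ.
  by_cases hf : form S (α * l) r (-1 / (y 0 + l)) < 0
  · have hη := hfirst (Or.inl hf)
    have hy0 : rho l α k * (1 + y 0) < 1 - y 0 := by
      have : 2 / (1 + rho l α k) - 1 = (1 - rho l α k) / (1 + rho l α k) := by field_simp; ring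
      have h3 : y 0 < (1 - rho l α k) / (1 + rho l α k) := by linarith
      rw [lt_div_iff₀ (by linarith)] at h3
      linarith
    have p1 : (1 - y k) * (1 + α * l) ≤ (1 - α * l) * (1 + y k) := by linarith
    have p2 : (2 - l) ^ k * (1 + y 0) * ((1 - y k) * (1 + α * l))
        ≤ (2 - l) ^ k * (1 + y 0) * ((1 - α * l) * (1 + y k)) :=
      mul_le_mul_of_nonneg_left p1 (mul_nonneg hM.le (by linarith))
    have p3 : (2 + l) ^ k * (1 + α * l) * (1 + y k) * (rho l α k * (1 + y 0))
        < (2 + l) ^ k * (1 + α * l) * (1 + y k) * (1 - y 0) :=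
      mul_lt_mul_of_pos_left hy0 (mul_pos (mul_pos hP (by linarith)) (by linarith))
    have p4 : (2 - l) ^ k * (1 + y 0) * ((1 - y k) * (1 + α * l))
        = (2 + l) ^ k * (1 + α * l) * (1 + y k) * (1 - y 0) := by
      linear_combination -(1 + α * l) * cross
    have p5 : (2 - l) ^ k * (1 + y 0) * ((1 - α * l) * (1 + y k))
        = (2 + l) ^ k * (1 + α * l) * (1 + y k) * (rho l α k * (1 + y 0)) := by
      linear_combination -(1 + y 0) * (1 + y k) * hρe
    linarith
  · push Not at hf
    have hfar := far_right h (by linarith) hf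
    have hG : 0 < (2 + l) * (1 - α * l) := mul_pos (by linarith) (by linarith)
    have hA : 0 ≤ (2 * α - 1) * l := mul_nonneg (by linarith) (by linarith)
    have hA1 : (2 * α - 1) * l ≤ 1 := by linarith
    have hy1 : 0 < y 0 - 1 := by
      by_contra hcon
      push Not at hcon
      nlinarith [mul_nonneg hA (neg_nonneg.2 hcon)]
    have hy2 : 1 - α * l ≤ y 0 - 1 := by nlinarith
    have hκ := w.lt_two
    have p1 : (2 + l) ^ k * (y 0 - 1) * (1 + y k) = (2 - l) ^ k * (1 + y 0) * (y k - 1) := by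
      linear_combination -cross
    have p2 : (2 - l) ^ k * (1 + y 0) * (y k - 1) ≤ (2 - l) ^ k * (1 + y 0) * (1 + y k) :=
      mul_le_mul_of_nonneg_left (by linarith) (mul_nonneg hM.le (by linarith))
    have p3 : (2 + l) ^ k * (y 0 - 1) ≤ (2 - l) ^ k * (1 + y 0) := by
      rw [← p1] at p2
      exact le_of_mul_le_mul_right p2 (by linarith)
    have p4 : (2 + l) ^ k * (1 - α * l) ≤ (2 - l) ^ k * 4 :=
      (mul_le_mul_of_nonneg_left hy2 hP.le).trans
        (p3.trans (mul_le_mul_of_nonneg_left (by linarith) hM.le))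
    have p5 : ((2 - l) / (2 + l)) ^ k < (1 - α * l) / 4 :=
      (pow_le_pow_of_le_one hq0 hq1.le hk).trans_lt hK
    rw [div_pow, div_lt_iff₀ hP] at p5
    linarith

theorem not_stretch_of_eq (h : SineSeq r l S) (h1 : α * l = 1) (k n : ℕ) (t v : ℕ → ℝ) :
    ¬ Stretch r l α S True n (n + (k + 1) * (r + 1)) (2 / (1 + rho l (1 / 2) k)) t v := by
  intro w
  have hl := h.one_lt
  have hl2 := h.lt_two
  have h0 : 1 / 2 ≤ α := by nlinarith
  obtain ⟨y, η, hy, hη, hb, hfirst⟩ := w.exists_chain h h0 h1.le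
  have cy := cross_rel hy
  have cη := cross_rel hη
  obtain ⟨b1, b2, b3⟩ := hb 0 (by omega)
  obtain ⟨d1, d2, d3⟩ := hb k le_rfl
  have hρ := rho_pos hl hl2 le_rfl (by linarith : 1 / 2 * l < 1) k
  set ρ := rho l (1 / 2) k with hρdef
  have hρe : (2 + l) ^ k * (2 + l) * ρ = (2 - l) ^ k * (2 - l) := by
    have e1 : 1 + 1 / 2 * l = (2 + l) / 2 := by ring
    have e2 : 1 - 1 / 2 * l = (2 - l) / 2 := by ring
    rw [hρdef, rho, div_pow, e1, e2]; field_simp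
  have hP : 0 < (2 + l) ^ k := by positivity
  have hM : 0 < (2 - l) ^ k := pow_pos (by linarith) k
  have hκ := w.lt_two
  have hκ' : 2 / (1 + ρ) * (1 + ρ) = 2 := by field_simp
  -- Here y₀ ≥ 1 and y₀ - η₀ < 2 give η₀ > -1, so the point is not at or left of r_{p-1}. Excluding
  -- equality gives y₀ > 1, which the blocks preserve.
  by_cases hf : WeakLT True (form S (α * l) r (-1 / (y 0 + l))) 0
  · have := hfirst hf
    linarith
  · have hf' : 0 < form S (α * l) r (-1 / (y 0 + l)) := by
      by_contra hc
      push Not at hc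
      exact hf (hc.lt_or_eq.imp id fun h' => ⟨trivial, h'⟩)
    have hy0 : 1 < y 0 := by
      rcases (h1 ▸ b1).lt_or_eq with h' | h'
      · exact h'
      · exfalso
        rw [← h', h.form_last, h1] at hf'
        have e : (1 * l / 2 - l ^ 2 / 2 + 1) * (-1 / (1 + l)) + (1 - l / 2) = 0 := by
          field_simp; ring
        linarith
    have hyk : 1 < y k := by
      by_contra hc
      push Not at hc
      have p1 : 0 ≤ (2 - l) ^ k * (1 + y 0) * (1 - y k) :=
        mul_nonneg (mul_nonneg hM.le (by linarith)) (by linarith)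
      have p2 : 0 < (2 + l) ^ k * (1 + y k) * (y 0 - 1) :=
        mul_pos (mul_pos hP (by linarith)) (by linarith)
      linarith
    -- The ratio (1 + η)/(1 - η) starts at no more than (2 - λ)/(2 + λ) and after k blocks is at
    -- most ρ; this bound demands that it exceed ρ.
    have q1 : 1 - 2 / (1 + ρ) < η k := by linarith
    have q2 : ρ * (1 - η k) < 1 + η k := by nlinarith
    have q3 : (1 + η 0) * (2 + l) ≤ (1 - η 0) * (2 - l) := by linarith
    have p1 : (2 - l) ^ k * (1 - η k) * ((1 + η 0) * (2 + l))
        ≤ (2 - l) ^ k * (1 - η k) * ((1 - η 0) * (2 - l)) :=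
      mul_le_mul_of_nonneg_left q3 (mul_nonneg hM.le (by linarith))
    have p2 : (2 + l) ^ k * (2 + l) * (1 - η 0) * (ρ * (1 - η k))
        < (2 + l) ^ k * (2 + l) * (1 - η 0) * (1 + η k) :=
      mul_lt_mul_of_pos_left q2 (mul_pos (mul_pos hP (by linarith)) (by linarith))
    have p3 : (2 - l) ^ k * (1 - η k) * ((1 - η 0) * (2 - l))
        = (2 + l) ^ k * (2 + l) * (1 - η 0) * (ρ * (1 - η k)) := by
      linear_combination -(1 - η k) * (1 - η 0) * hρe
    have p4 : (2 - l) ^ k * (1 - η k) * ((1 + η 0) * (2 + l))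
        = (2 + l) ^ k * (2 + l) * (1 - η 0) * (1 + η k) := by
      linear_combination -(2 + l) * cη
    linarith

end AlphaRosen

/-! ### From large coefficients to a stretch, and the theorem -/

namespace AlphaRosen

variable {r : ℕ} {l α : ℝ} {S : ℕ → ℝ} {st : Prop}

/-- If all `Θ_j` from `n - 1` to `n + k (p - 1)` were at least `c`, they would form a stretch. -/
theorem stretch_of_Theta (h : SineSeq r l S) (h0 : 1 / 2 ≤ α) (h1 : α * l ≤ 1)
    (hst : st → 1 / 2 < α) {x : ℝ} (hx : ¬ IsGRational l x) {n e : ℕ} {ρ : ℝ} (hn : 1 ≤ n)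
    (hρ : 0 < ρ) (hΘ : ∀ j, n - 1 ≤ j → j ≤ e → (1 + ρ) / 2 ≤ Theta l α x j) :
    Stretch r l α S st n e (2 / (1 + ρ)) (fun i => ((natExt l α)^[i] (fracPart l α x, 0)).1)
      (fun i => ((natExt l α)^[i] (fracPart l α x, 0)).2) := by
  have hinv : ∀ i, Inv r l α S st False ((natExt l α)^[i] (fracPart l α x, 0)).1
      ((natExt l α)^[i] (fracPart l α x, 0)).2 := fun i =>
    h.Inv_iterate h0 h1 hst (P := (fracPart l α x, 0)) (h.Inv_start x) i
  have main : ∀ i, n ≤ i → i ≤ e → ((natExt l α)^[i] (fracPart l α x, 0)).1 < 0 ∧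
      -1 / ((natExt l α)^[i] (fracPart l α x, 0)).1 - ((natExt l α)^[i] (fracPart l α x, 0)).2
        ≤ 2 / (1 + ρ) ∧ 0 < ((natExt l α)^[i] (fracPart l α x, 0)).2 := by
    intro i hi hie
    obtain ⟨m, rfl⟩ : ∃ m, i = m + 1 := ⟨i - 1, by omega⟩
    have hI := hinv (m + 1)
    obtain ⟨t0, v0, -, T1, T2⟩ := h.Theta_eq h0 h1 hx m
      (t := ((natExt l α)^[m + 1] (fracPart l α x, 0)).1)
      (v := ((natExt l α)^[m + 1] (fracPart l α x, 0)).2) rfl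
    have c1 := hΘ (m + 1) (by omega) hie
    have c2 := hΘ m (by omega) (by omega)
    rw [T1] at c1
    rw [T2] at c2
    have hpos := h.one_add_mul_pos h0 hI
    generalize ((natExt l α)^[m + 1] (fracPart l α x, 0)).1 = t at *
    generalize ((natExt l α)^[m + 1] (fracPart l α x, 0)).2 = v at *
    have hv1 := hI.le_one
    have ht1 := hI.right
    rw [le_div_iff₀ hpos] at c1 c2
    -- For t ≥ 0 both coefficients exceeding 1/2 would give t + v > 1 + tv, contradicting (1 - t)(1
    -- - v) ≥ 0.
    have ht : t < 0 := by
      by_contra hc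
      push Not at hc
      rw [abs_of_nonneg hc] at c1
      nlinarith [mul_nonneg (by linarith : 0 ≤ 1 - t) (by linarith : 0 ≤ 1 - v)]
    refine ⟨ht, ?_, v0⟩
    rw [abs_of_neg ht] at c1
    have e1 : -1 / t - v = (1 + t * v) / (-t) := by field_simp; ring
    rw [e1, div_le_div_iff₀ (by linarith) (by linarith)]
    linarith
  exact ⟨hinv, fun i => Function.iterate_succ_apply' _ _ _, fun i a b => (main i a b).1,
    fun i a b => (main i a b).2.1, fun i a b => (main i a b).2.2,
    by rw [div_lt_iff₀ (by linarith)]; linarith⟩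

/-- The conclusion about the minimum of consecutive approximation coefficients. -/
theorem min_Theta_lt (h : SineSeq r l S) (h0 : 1 / 2 ≤ α) (h1 : α * l ≤ 1)
    (hst : st → 1 / 2 < α) {β : ℝ} (hβ0 : 1 / 2 ≤ β) (hβ1 : β * l < 1) {K : ℕ}
    (hK : ∀ k, K ≤ k → ∀ n t v,
      ¬ Stretch r l α S st n (n + (k + 1) * (r + 1)) (2 / (1 + rho l β k)) t v)
    {x : ℝ} (hx : ¬ IsGRational l x) {n k : ℕ} (hn : 1 ≤ n) (hk : K + 1 < k)
    (hne : (Finset.Icc (n - 1) (n + k * (r + 1))).Nonempty) :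
    (Finset.Icc (n - 1) (n + k * (r + 1))).inf' hne (Theta l α x)
      < c (tau l β) (fun _ => l - 1) k := by
  rw [c_tau h.one_lt h.lt_two hβ0 hβ1]
  by_contra hc
  push Not at hc
  rw [Finset.le_inf'_iff] at hc
  -- The constant c_k involves ρ_{k-1}, which is why the threshold is shifted by one.
  obtain ⟨k, rfl⟩ : ∃ m, k = m + 1 := ⟨k - 1, by omega⟩
  rw [Nat.add_sub_cancel] at hc
  exact hK k (by omega) n _ _ (stretch_of_Theta h h0 h1 hst hx hn
    (rho_pos h.one_lt h.lt_two hβ0 hβ1 k) fun j a b => hc j (Finset.mem_Icc.2 ⟨a, b⟩))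

end AlphaRosen

open AlphaRosen in
theorem mainTheorem2 (p q : ℕ) (hp : 3 ≤ p) (hq : q = 2 * p) (l : ℝ)
    (hl : l = 2 * Real.cos (Real.pi / q)) (α : ℝ) (hα : α ∈ Set.Icc (1 / 2) (1 / l)) :
    ∃ τ ν : ℕ → ℝ,
      (∀ k : ℕ, AlphaRosen.backward l α p k = {(τ k, ν k)}) ∧
      (∃ K : ℕ, 0 < K ∧ ∀ x : ℝ, ¬ AlphaRosen.IsGRational l x →
        ∀ n k : ℕ, 1 ≤ n → K < k →
          (Finset.Icc (n - 1) (n + k * (p - 1))).inf' (Finset.nonempty_Icc.mpr (by omega))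
            (AlphaRosen.Theta l α x) < AlphaRosen.c τ ν k) ∧
      (∀ k : ℕ, 1 ≤ k → AlphaRosen.c τ ν (k + 1) < AlphaRosen.c τ ν k) ∧
      Tendsto (AlphaRosen.c τ ν) atTop (𝓝 (1 / 2)) := by
  obtain ⟨r, rfl⟩ : ∃ r, p = r + 2 := ⟨p - 2, by omega⟩
  have hr : 1 ≤ r := by omega
  subst hq
  obtain ⟨S, h⟩ := exists_sineSeq hr (l := l) (by rw [hl]; push_cast; rfl)
  obtain ⟨hα0, hα1⟩ := hα
  have hl1 := h.one_lt
  have hl2 := h.lt_two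
  have hl0 : 0 < l := by linarith
  have hαl : α * l ≤ 1 := by rwa [le_div_iff₀ hl0] at hα1
  have limits : ∀ β : ℝ, 1 / 2 ≤ β → β * l < 1 →
      (∀ k : ℕ, 1 ≤ k → c (tau l β) (fun _ => l - 1) (k + 1) < c (tau l β) (fun _ => l - 1) k) ∧
      Tendsto (c (tau l β) (fun _ => l - 1)) atTop (𝓝 (1 / 2)) := by
    intro β hβ0 hβ1
    have hc := c_tau hl1 hl2 hβ0 hβ1
    constructor
    · intro k hk
      obtain ⟨k, rfl⟩ : ∃ m, k = m + 1 := ⟨k - 1, by omega⟩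
      rw [hc, hc]
      have := rho_succ_lt hl1 hl2 hβ0 hβ1 k
      simp only [Nat.add_sub_cancel]
      linarith
    · rw [← tendsto_add_atTop_iff_nat 1]
      simp only [hc, Nat.add_sub_cancel]
      have := ((tendsto_rho (β := β) hl1 hl2).const_add 1).div_const 2
      rwa [add_zero] at this
  by_cases hcase : α = 1 / l
  · have hαe : α * l = 1 := by rw [hcase]; field_simp
    have hβ1 : 1 / 2 * l < 1 := by linarith
    have hα2 : 1 / 2 < α := by nlinarith
    refine ⟨tau l (1 / 2), fun _ => l - 1, fun k => ?_, ⟨1, one_pos, fun x hx n k hn hk => ?_⟩,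
      limits _ le_rfl hβ1⟩
    · have e : -2 / (3 * l) = tau l (1 / 2) 0 := by
        rw [tau_zero (by positivity), delta]; field_simp; norm_num
      rw [backward, if_pos hcase, e]
      exact h.preimages_eq hr le_rfl hβ1 k
    · exact min_Theta_lt (st := True) (K := 0) h hα0 hαl (fun _ => hα2) le_rfl hβ1
        (fun k _ n t v => not_stretch_of_eq h hαe k n t v) hx hn hk _
  · have hαe : α * l < 1 := by
      refine hαl.lt_of_ne fun h' => hcase ?_
      rw [eq_div_iff hl0.ne', h']
    obtain ⟨K, hK⟩ := not_stretch_of_lt h hα0 hαe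
    refine ⟨tau l α, fun _ => l - 1, fun k => ?_, ⟨K + 1, K.succ_pos, fun x hx n k hn hk => ?_⟩,
      limits _ hα0 hαe⟩
    · rw [backward, if_neg hcase, ← tau_zero (by nlinarith)]
      exact h.preimages_eq hr hα0 hαe k
    · exact min_Theta_lt (st := False) h hα0 hαl False.elim hα0 hαe hK hx hn hk _
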